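/- Let $S=K[x_1,\dots,x_n]$ be the standard graded polynomial ring over a field $K$, with $\mathfrak m=(x_1,\dots,x_n)$, and let $I\subset S$ be a monomial ideal with $0\ne I\ne S$. Let $\mathcal G(I)$ be its minimal monomial generating set, $\alpha(I)=\min\{d:(I/\mathfrak mI)_d\ne0\}$, let $\partial(I)$ be the ideal generated by all partial derivatives $\partial u/\partial x_i$ with $u\in\mathcal G(I)$, $1\le i\le n$, and for a nonzero homogeneous ideal $J$ let $$\operatorname{reg}J=\max\{j-i:\ \dim_K\operatorname{Tor}^S_i(K,J)_j\ne0\}.$$ Assume that $\partial(I)=(u/x_i:\ u\in\mathcal G(I),\ x_i\mid u)$; this holds, for example, if $\operatorname{char}K$ is zero or larger than every exponent occurring in the elements of $\mathcal G(I)$. Then the maximum defining $\operatorname{reg}\partial(I)$ exists, and the following hold. (a) $\alpha(I)-1\le\operatorname{reg}\partial(I)$. (b) If $I$ contains at most one of the variables $x_1,\dots,x_n$, then $$\operatorname{reg}\partial(I)\ \le\ \sum_{u\in\mathcal G(I)}\deg(u)-2|\mathcal G(I)|+1.$$ (c) If $I$ is a complete intersection (that is, generated by a regular sequence of $S$), and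 either $I$ contains none of the variables or $I=(x_i)$ for some $i$, then equality holds in (b). -/

import Mathlib

open MvPolynomial

noncomputable section

namespace MonomialGradient

variable {K : Type*} [Field K] {n : ℕ}

/-- A monomial ideal of `K[x₁, …, xₙ]`: an ideal generated by monomials. -/
def IsMonomialIdeal (I : Ideal (MvPolynomial (Fin n) K)) : Prop :=
  ∃ A : Set (Fin n →₀ ℕ), I = Ideal.span ((fun a => monomial a (1 : K)) '' A)

/-- The exponents of the monomials of `I` that are minimal for divisibility. -/
def minGenSet (I : Ideal (MvPolynomial (Fin n) K)) : Set (Fin n →₀ ℕ) :=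
  {a | Minimal (fun b => monomial b (1 : K) ∈ I) a}

theorem minGenSet_finite (I : Ideal (MvPolynomial (Fin n) K)) : (minGenSet I).Finite := by
  apply WellQuasiOrderedLE.finite_of_isAntichain
  intro a ha b hb hab hle
  exact hab (hle.antisymm (hb.2 ha.1 hle))

/-- `𝒢(I)`, the minimal monomial generating set of a monomial ideal `I`, given through the
exponent vectors: `a ∈ minGens I` stands for the generator `x^a`, whose degree is `a.degree`. -/
def minGens (I : Ideal (MvPolynomial (Fin n) K)) : Finset (Fin n →₀ ℕ) :=
  (minGenSet_finite I).toFinset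

/-- The gradient ideal `∂(I)` of a monomial ideal: it is generated by all the partial derivatives
of the minimal monomial generators. -/
def gradientIdeal (I : Ideal (MvPolynomial (Fin n) K)) : Ideal (MvPolynomial (Fin n) K) :=
  Ideal.span {f | ∃ a ∈ minGens I, ∃ i : Fin n, f = pderiv i (monomial a (1 : K))}

/-- `∂*(I) = (u / xᵢ : u ∈ 𝒢(I), i ∈ supp u)`. -/
def starGradientIdeal (I : Ideal (MvPolynomial (Fin n) K)) : Ideal (MvPolynomial (Fin n) K) :=
  Ideal.span {f | ∃ a ∈ minGens I, ∃ i ∈ a.support,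
    f = monomial (a - Finsupp.single i 1) (1 : K)}

/-- The graded maximal ideal `𝔪 = (x₁, …, xₙ)`. -/
def irrelevantIdeal (K : Type*) [Field K] (n : ℕ) : Ideal (MvPolynomial (Fin n) K) :=
  Ideal.span (Set.range X)

/-- `α(I) = min {d : (I / 𝔪 I)_d ≠ 0}`, for a nonzero homogeneous ideal `I`. -/
def initialDegree (I : Ideal (MvPolynomial (Fin n) K)) : ℕ :=
  sInf {d | ∃ f ∈ I, f.IsHomogeneous d ∧ f ∉ irrelevantIdeal K n * I}

/-- `I` is a complete intersection: it is generated by a regular sequence of `K[x₁, …, xₙ]`. -/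
def IsCompleteIntersection (I : Ideal (MvPolynomial (Fin n) K)) : Prop :=
  ∃ rs : List (MvPolynomial (Fin n) K),
    RingTheory.Sequence.IsRegular (MvPolynomial (Fin n) K) rs ∧ I = Ideal.ofList rs

/-! ### Graded `Tor` of the residue field

`Tor_i(K, J)` is computed from the graded free resolution of `K = S / 𝔪` given by the Koszul complex
`Koszul_i = ⨁_{|A| = i} S e_A` of `x₁, …, xₙ`, where `A` runs over the subsets of `{1, …, n}`, `e_A`
has degree `|A|`, and `d e_A = ∑_{p ∈ A} (-1)^{#{q ∈ A : q < p}} x_p e_{A \ p}`.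
A chain `∑_A f_A e_A` is the function `A ↦ f_A`. -/

/-- The Koszul differential. The coefficient of `e_B` in `d (∑_A f_A e_A)` is
`∑_{p ∉ B} (-1)^{#{q ∈ B : q < p}} x_p f_{B ∪ p}`. -/
def koszulD (K : Type*) [Field K] (n : ℕ) :
    (Finset (Fin n) → MvPolynomial (Fin n) K) →ₗ[K]
      (Finset (Fin n) → MvPolynomial (Fin n) K) where
  toFun f B := ∑ p ∈ Bᶜ, (-1) ^ (B.filter (· < p)).card * (X p * f (insert p B))
  map_add' f g := by
    funext B
    simp only [Pi.add_apply, mul_add, Finset.sum_add_distrib]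
  map_smul' c f := by
    funext B
    simp only [Pi.smul_apply, mul_smul_comm, Finset.smul_sum, RingHom.id_apply]

/-- The Koszul differential squares to zero. -/
theorem koszulD_koszulD (f : Finset (Fin n) → MvPolynomial (Fin n) K) :
    koszulD K n (koszulD K n f) = 0 := by
  funext B
  have : koszulD K n (koszulD K n f) B = ∑ x ∈ Bᶜ.sigma fun p => (insert p B)ᶜ,
      (-1) ^ (B.filter (· < x.1)).card * (X x.1 *
        ((-1) ^ ((insert x.1 B).filter (· < x.2)).card * (X x.2 * f (insert x.2 (insert x.1 B))))) := by
    rw [Finset.sum_sigma]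
    simp only [koszulD, LinearMap.coe_mk, AddHom.coe_mk, Finset.mul_sum]
  rw [this]
  refine Finset.sum_involution (fun x _ => ⟨x.2, x.1⟩) ?_ ?_ ?_ ?_
  · rintro ⟨p, q⟩ h
    simp only [Finset.mem_sigma, Finset.mem_compl, Finset.mem_insert, not_or] at h
    obtain ⟨hp, hqp, hq⟩ := h
    simp only [Finset.filter_insert]
    rw [Finset.insert_comm p q]
    rcases lt_or_gt_of_ne hqp with hh | hh
    · rw [if_neg (not_lt.2 hh.le), if_pos hh, Finset.card_insert_of_notMem (by simp [hq])]
      ring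
    · rw [if_neg (not_lt.2 hh.le), if_pos hh, Finset.card_insert_of_notMem (by simp [hp])]
      ring
  · rintro ⟨p, q⟩ h _ h2
    simp only [Finset.mem_sigma, Finset.mem_compl, Finset.mem_insert, not_or] at h
    simp at h2
    exact h.2.1 h2.1
  · rintro ⟨p, q⟩ h
    simp only [Finset.mem_sigma, Finset.mem_compl, Finset.mem_insert, not_or] at h ⊢
    tauto
  · intros; rfl

/-- The degree `j` part of `Koszul_i ⊗ J`: the chains `∑_{|A| = i} f_A e_A` whose coefficients
`f_A` lie in `J` and are homogeneous of degree `j - i`. -/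
def koszulChains (J : Ideal (MvPolynomial (Fin n) K)) (i j : ℕ) :
    Submodule K (Finset (Fin n) → MvPolynomial (Fin n) K) where
  carrier := {f | ∀ A, f A ∈ J ∧ ∀ m ∈ (f A).support, A.card = i ∧ m.degree + A.card = j}
  add_mem' {f g} hf hg A := by
    refine ⟨J.add_mem (hf A).1 (hg A).1, fun m hm => ?_⟩
    rcases Finset.mem_union.1 (support_add hm) with h | h
    · exact (hf A).2 m h
    · exact (hg A).2 m h
  zero_mem' A := by simp
  smul_mem' c f hf A := by
    refine ⟨J.smul_of_tower_mem c (hf A).1, fun m hm => (hf A).2 m (support_smul hm)⟩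

/-- The cycles of the degree `j` strand of `Koszul ⊗ J` in homological degree `i`. -/
def koszulCycles (J : Ideal (MvPolynomial (Fin n) K)) (i j : ℕ) :
    Submodule K (Finset (Fin n) → MvPolynomial (Fin n) K) :=
  koszulChains J i j ⊓ LinearMap.ker (koszulD K n)

/-- The boundaries of the degree `j` strand of `Koszul ⊗ J` in homological degree `i`. -/
def koszulBoundaries (J : Ideal (MvPolynomial (Fin n) K)) (i j : ℕ) :
    Submodule K (Finset (Fin n) → MvPolynomial (Fin n) K) :=
  (koszulChains J (i + 1) j).map (koszulD K n)

/-- `Tor_i(K, J)_j`. -/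
abbrev GradedTor (J : Ideal (MvPolynomial (Fin n) K)) (i j : ℕ) : Type _ :=
  koszulCycles J i j ⧸ (koszulBoundaries J i j).submoduleOf (koszulCycles J i j)

/-- The graded Betti number `β_{i,j}(J) = dim_K Tor_i(K, J)_j`. -/
def gradedBetti (J : Ideal (MvPolynomial (Fin n) K)) (i j : ℕ) : ℕ :=
  Module.finrank K (GradedTor J i j)

/-- The set `{j - i : β_{i,j}(J) ≠ 0}`, whose maximum is the regularity of `J`. -/
def regSet (J : Ideal (MvPolynomial (Fin n) K)) : Set ℤ :=
  {r | ∃ i j : ℕ, gradedBetti J i j ≠ 0 ∧ r = (j : ℤ) - (i : ℤ)}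

/-- The Castelnuovo-Mumford regularity `reg J = max {j - i : β_{i,j}(J) ≠ 0}`, for a nonzero
homogeneous ideal `J`. -/
def regularity (J : Ideal (MvPolynomial (Fin n) K)) : ℤ :=
  sSup (regSet J)

end MonomialGradient

end

/-! By hypothesis J = ∂(I) is the monomial ideal generated by the quotients u/x_p, so the theorem is
about where its Koszul homology lives.

Upper bound. A Mayer-Vietoris induction on the generators (`exists_degree_sup_eq_of_not_le`) shows
that Tor_i(K, J)_j ≠ 0 forces j = deg lcm(F) for a set F of i + 1 generators, as in the Taylor
complex. Hence `regSet` is bounded and its maximum exists. Sort F by the generator u that each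
element comes from. When deg u ≥ 2, a fibre with k elements has an lcm of degree at most deg u - 2 +
k, and summing gives j - i ≤ ∑ (deg u - 2) + 1. If I contains exactly one variable, then J = S has
regularity 0 and the bound is nonnegative. For (a), a quotient u/x_p of least degree survives in
Tor_0.

Equality. A monomial complete intersection has generators with disjoint supports
(`IsCompleteIntersection.pairwise_disjoint_support`). For each u pick a set A_u of one or two
variables and a monomial c_u of degree deg u - 2 such that c_u x_p is some u/x_i for every p ∈ A_u.
Put C = ∏ c_u and U = ⋃ A_u. The boundary of C e_U has coefficients in J and sits at j - i = deg C +
1, which is the bound. Were it a boundary over J, exactness of the Koszul complex of S would give C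
e_U = w + dy with w over J. An iterated contraction with suitable linear forms (`Detects`) excludes
this: at e_∅, in the multidegree of C e_U, it is ±1 on C e_U but 0 on w and on dy. -/

open MvPolynomial

noncomputable section

namespace MonomialGradient

/-! ### Contractions on the exterior algebra -/

section Contraction

variable {R : Type*} [CommRing R] {n : ℕ}

/-- Contraction of the exterior algebra `⨁ R e_A` with the linear form `e_p ↦ g p`. -/
def contraction (g : Fin n → R) : (Finset (Fin n) → R) →ₗ[R] (Finset (Fin n) → R) where
  toFun f B := ∑ p ∈ Bᶜ, (-1) ^ (B.filter (· < p)).card * (g p * f (insert p B))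
  map_add' f g := by
    funext B
    simp only [Pi.add_apply, mul_add, Finset.sum_add_distrib]
  map_smul' c f := by
    funext B
    simp only [Pi.smul_apply, smul_eq_mul, Finset.mul_sum, RingHom.id_apply]
    exact Finset.sum_congr rfl fun _ _ => by ring

theorem contraction_apply (g : Fin n → R) (f : Finset (Fin n) → R) (B : Finset (Fin n)) :
    contraction g f B =
      ∑ p ∈ Bᶜ, (-1) ^ (B.filter (· < p)).card * (g p * f (insert p B)) := rfl

theorem contraction_contraction_self (g : Fin n → R) (f : Finset (Fin n) → R) :
    contraction g (contraction g f) = 0 := by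
  funext B
  have : contraction g (contraction g f) B = ∑ x ∈ Bᶜ.sigma fun p => (insert p B)ᶜ,
      (-1) ^ (B.filter (· < x.1)).card * (g x.1 *
        ((-1) ^ ((insert x.1 B).filter (· < x.2)).card * (g x.2 * f (insert x.2 (insert x.1 B))))) := by
    rw [Finset.sum_sigma]
    simp only [contraction_apply, Finset.mul_sum]
  rw [this]
  refine Finset.sum_involution (fun x _ => ⟨x.2, x.1⟩) ?_ ?_ ?_ ?_
  · rintro ⟨p, q⟩ h
    simp only [Finset.mem_sigma, Finset.mem_compl, Finset.mem_insert, not_or] at h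
    obtain ⟨hp, hqp, hq⟩ := h
    simp only [Finset.filter_insert]
    rw [Finset.insert_comm p q]
    rcases lt_or_gt_of_ne hqp with hh | hh
    · rw [if_neg (not_lt.2 hh.le), if_pos hh, Finset.card_insert_of_notMem (by simp [hq])]
      ring
    · rw [if_neg (not_lt.2 hh.le), if_pos hh, Finset.card_insert_of_notMem (by simp [hp])]
      ring
  · rintro ⟨p, q⟩ h _ h2
    simp only [Finset.mem_sigma, Finset.mem_compl, Finset.mem_insert, not_or] at h
    simp at h2
    exact h.2.1 h2.1
  · rintro ⟨p, q⟩ h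
    simp only [Finset.mem_sigma, Finset.mem_compl, Finset.mem_insert, not_or] at h ⊢
    tauto
  · intros; rfl

theorem contraction_add (g h : Fin n → R) (f : Finset (Fin n) → R) :
    contraction (g + h) f = contraction g f + contraction h f := by
  funext B
  simp only [contraction_apply, Pi.add_apply, add_mul, mul_add, Finset.sum_add_distrib]

/-- Polarization of the square-zero identity, applied to g + h. -/
theorem contraction_anticomm (g h : Fin n → R) (f : Finset (Fin n) → R) :
    contraction g (contraction h f) = -contraction h (contraction g f) := by
  have key := contraction_contraction_self (g + h) f
  simp only [contraction_add, map_add, contraction_contraction_self, zero_add, add_zero] at key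
  exact eq_neg_of_add_eq_zero_right key

theorem contraction_mem (Q : Ideal R) {g : Fin n → R} {f : Finset (Fin n) → R}
    (h : ∀ B, ∀ p ∉ B, g p * f (insert p B) ∈ Q) (B : Finset (Fin n)) : contraction g f B ∈ Q :=
  Q.sum_mem fun p hp => Q.mul_mem_left _ (h B p (by simpa using hp))

/-- Contraction of `c e_B` with a form that vanishes on all but one element of `B`. -/
theorem contraction_single {g : Fin n → R} {B : Finset (Fin n)} {p : Fin n} (hp : p ∉ B)
    (hg : ∀ q ∈ B, g q = 0) (c : R) :
    contraction g (Pi.single (insert p B) c) =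
      Pi.single B ((-1) ^ (B.filter (· < p)).card * (g p * c)) := by
  funext C
  rw [contraction_apply]
  by_cases hC : C = B
  · subst hC
    rw [Finset.sum_eq_single p]
    · simp
    · intro q hq hqp
      have : insert q C ≠ insert p C := by
        intro h
        have : q ∈ insert p C := h ▸ Finset.mem_insert_self q C
        simp at hq
        simp [hqp, hq] at this
      simp [this]
    · intro h
      exact absurd (by simpa using hp) h
  · rw [Pi.single_eq_of_ne hC]
    refine Finset.sum_eq_zero fun q hq => ?_
    by_cases h : insert q C = insert p B
    · have hqm : q ∈ insert p B := h ▸ Finset.mem_insert_self q C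
      rcases Finset.mem_insert.1 hqm with rfl | hqB
      · exfalso
        apply hC
        rw [← Finset.erase_insert hp, ← h, Finset.erase_insert (by simpa using hq)]
      · simp [hg q hqB]
    · simp [h]

/-- Multiplication by `e_p` on the exterior algebra. -/
def wedge (p : Fin n) (f : Finset (Fin n) → R) (A : Finset (Fin n)) : R :=
  if p ∈ A then (-1) ^ (A.filter (· < p)).card * f (A.erase p) else 0

/-- Cartan's homotopy formula: contraction is an antiderivation, so e_p ∧ - is a homotopy from
multiplication by g p to zero. -/
theorem contraction_wedge (g : Fin n → R) (p : Fin n) (f : Finset (Fin n) → R) :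
    contraction g (wedge p f) + wedge p (contraction g f) = g p • f := by
  funext B
  simp only [Pi.add_apply, Pi.smul_apply, smul_eq_mul]
  by_cases hp : p ∈ B
  · obtain ⟨C, hpC, rfl⟩ : ∃ C, p ∉ C ∧ insert p C = B :=
      ⟨B.erase p, by simp, Finset.insert_erase hp⟩
    have hsq : ∀ (k : ℕ) (x : R), (-1) ^ k * ((-1) ^ k * x) = x := fun k x => by
      rw [← mul_assoc, ← mul_pow]; simp
    have hc : Cᶜ = insert p (insert p C)ᶜ := by
      ext q; by_cases h : q = p <;> simp [h, hpC]
    rw [contraction_apply, wedge, if_pos hp, contraction_apply, Finset.erase_insert hpC, hc,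
      Finset.sum_insert (by simp), mul_add, Finset.filter_insert, if_neg (lt_irrefl p), hsq,
      add_left_comm, add_eq_left, Finset.mul_sum, ← Finset.sum_add_distrib]
    refine Finset.sum_eq_zero fun q hq => ?_
    simp only [Finset.mem_compl, Finset.mem_insert, not_or] at hq
    obtain ⟨hqp, hqC⟩ := hq
    have hw : wedge p f (insert q (insert p C)) =
        (-1) ^ ((insert q (insert p C)).filter (· < p)).card * f (insert q C) := by
      rw [wedge, if_pos (by simp), Finset.insert_comm, Finset.erase_insert (by simp [hpC, Ne.symm hqp])]
    rw [hw]
    simp only [Finset.filter_insert, lt_irrefl, if_false]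
    rcases lt_or_gt_of_ne hqp with hh | hh
    · rw [if_neg (not_lt.2 hh.le), if_pos hh, Finset.card_insert_of_notMem (by simp [hqC])]
      ring
    · rw [if_neg (not_lt.2 hh.le), if_pos hh, Finset.card_insert_of_notMem (by simp [hpC])]
      ring
  · rw [contraction_apply, Finset.sum_eq_single p]
    · have : (insert p B).filter (· < p) = B.filter (· < p) := by
        rw [Finset.filter_insert, if_neg (lt_irrefl p)]
      rw [wedge, wedge, if_pos (Finset.mem_insert_self p B), if_neg hp, Finset.erase_insert hp, this,
        add_zero]
      rcases neg_one_pow_eq_or R (B.filter (· < p)).card with h | h <;> simp [h]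
    · intro q _ hqp
      have : p ∉ insert q B := by simp [hp, Ne.symm hqp]
      simp [wedge, this]
    · intro h
      exact absurd (by simpa using hp) h

end Contraction

/-! ### Exactness of the Koszul complex of the variables -/

section Exactness

variable {K : Type*} [Field K] {n : ℕ}

theorem koszulD_eq_contraction (f : Finset (Fin n) → MvPolynomial (Fin n) K) :
    koszulD K n f = contraction X f := rfl

theorem coeff_modMonomial_single (p : Fin n) (f : MvPolynomial (Fin n) K) (m : Fin n →₀ ℕ) :
    coeff m (f.modMonomial (Finsupp.single p 1)) = if m p = 0 then coeff m f else 0 := by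
  have hle : Finsupp.single p 1 ≤ m ↔ m p ≠ 0 := by
    rw [Finsupp.single_le_iff]; omega
  split_ifs with h
  · exact coeff_modMonomial_of_not_le _ (by rw [hle]; exact not_not.2 h)
  · exact coeff_modMonomial_of_le _ (hle.2 h)

theorem modMonomial_X_mul (p q : Fin n) (f : MvPolynomial (Fin n) K) :
    (X q * f).modMonomial (Finsupp.single p 1) =
      if q = p then 0 else X q * f.modMonomial (Finsupp.single p 1) := by
  ext m
  split_ifs with h
  · subst h
    simp only [coeff_modMonomial_single, coeff_X_mul', coeff_zero]
    split_ifs with h1 h2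
    · simp [h1] at h2
    · rfl
    · rfl
  · have hp : (m - Finsupp.single q 1 : Fin n →₀ ℕ) p = m p := by simp [h]
    simp only [coeff_modMonomial_single, coeff_X_mul', hp]
    split_ifs <;> rfl

theorem modMonomial_add (p : Fin n) (f g : MvPolynomial (Fin n) K) :
    (f + g).modMonomial (Finsupp.single p 1) =
      f.modMonomial (Finsupp.single p 1) + g.modMonomial (Finsupp.single p 1) := by
  ext m
  simp only [coeff_modMonomial_single, coeff_add]
  split_ifs <;> simp

/-- The reduction modulo `X p` and `e_p`. -/
def dropVar (p : Fin n) (f : Finset (Fin n) → MvPolynomial (Fin n) K) (A : Finset (Fin n)) :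
    MvPolynomial (Fin n) K :=
  if p ∈ A then 0 else (f A).modMonomial (Finsupp.single p 1)

theorem dropVar_zero (p : Fin n) :
    dropVar p (0 : Finset (Fin n) → MvPolynomial (Fin n) K) = 0 := by
  funext B
  refine MvPolynomial.ext _ _ fun m => ?_
  rw [dropVar]
  split_ifs
  · rfl
  · rw [coeff_modMonomial_single]
    simp

theorem modMonomial_sum {ι : Type*} (p : Fin n) (s : Finset ι) (f : ι → MvPolynomial (Fin n) K) :
    (∑ i ∈ s, f i).modMonomial (Finsupp.single p 1) =
      ∑ i ∈ s, (f i).modMonomial (Finsupp.single p 1) :=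
  map_sum (AddMonoidHom.mk' (fun f : MvPolynomial (Fin n) K =>
    f.modMonomial (Finsupp.single p 1)) (modMonomial_add p)) f s

theorem modMonomial_neg_one_pow_mul (p : Fin n) (k : ℕ) (f : MvPolynomial (Fin n) K) :
    ((-1) ^ k * f).modMonomial (Finsupp.single p 1) =
      (-1) ^ k * f.modMonomial (Finsupp.single p 1) := by
  have hneg : ∀ f : MvPolynomial (Fin n) K, (-f).modMonomial (Finsupp.single p 1) =
      -(f.modMonomial (Finsupp.single p 1)) := fun f => by
    ext m
    simp only [coeff_modMonomial_single, coeff_neg]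
    split_ifs <;> simp
  rcases neg_one_pow_eq_or (MvPolynomial (Fin n) K) k with h | h <;> simp [h, hneg]

theorem koszulD_dropVar (p : Fin n) (f : Finset (Fin n) → MvPolynomial (Fin n) K) :
    koszulD K n (dropVar p f) = dropVar p (koszulD K n f) := by
  funext B
  simp only [koszulD_eq_contraction, contraction_apply, dropVar]
  split_ifs with hp
  · exact Finset.sum_eq_zero fun q _ => by simp [hp]
  · rw [modMonomial_sum]
    refine Finset.sum_congr rfl fun q hq => ?_
    rw [modMonomial_neg_one_pow_mul, modMonomial_X_mul]
    by_cases h : q = p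
    · simp [h]
    · simp [h, hp, Ne.symm h]

/-- The part of a cycle that involves `X p` or `e_p` is a boundary. -/
theorem exists_koszulD_eq_sub_dropVar {i j : ℕ} (p : Fin n)
    {z : Finset (Fin n) → MvPolynomial (Fin n) K} (hz : z ∈ koszulCycles ⊤ i j) :
    ∃ y ∈ koszulChains (⊤ : Ideal (MvPolynomial (Fin n) K)) (i + 1) j,
      koszulD K n y = z - dropVar p z := by
  have hdz : koszulD K n z = 0 := hz.2
  set z' := z - dropVar p z with hz'
  have hd : koszulD K n z' = 0 := by
    rw [hz', map_sub, koszulD_dropVar, hdz]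
    rw [dropVar_zero, sub_zero]
  -- This is e_p ∧ z' divided by x_p: wedging with e_p retains only the coefficients of z' at sets
  -- without p, and there z' is the part of z divisible by x_p. The homotopy formula then reads x_p
  -- · dy = x_p · z', and x_p cancels.
  let y : Finset (Fin n) → MvPolynomial (Fin n) K := fun A =>
    if p ∈ A then (-1) ^ (A.filter (· < p)).card *
      (z (A.erase p)).divMonomial (Finsupp.single p 1) else 0
  have hy : (X p : MvPolynomial (Fin n) K) • y = wedge p z' := by
    funext A
    simp only [Pi.smul_apply, smul_eq_mul, wedge, y]
    split_ifs with h
    · rw [mul_left_comm]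
      congr 1
      simp only [hz', Pi.sub_apply, dropVar, Finset.notMem_erase, if_false]
      rw [eq_sub_iff_add_eq]
      exact divMonomial_add_modMonomial_single _ _
    · simp
  refine ⟨y, fun A => ⟨trivial, fun m hm => ?_⟩, ?_⟩
  · by_cases h : p ∈ A
    · have hm' : m + Finsupp.single p 1 ∈ (z (A.erase p)).support := by
        simp only [y, if_pos h] at hm
        rw [mem_support_iff] at hm ⊢
        intro h0
        apply hm
        rcases neg_one_pow_eq_or (MvPolynomial (Fin n) K) (A.filter (· < p)).card with h' | h' <;>
          simp [h', coeff_divMonomial, add_comm, h0]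
      have := (hz.1 _).2 _ hm'
      have hc := Finset.card_erase_add_one h
      rw [map_add, Finsupp.degree_single] at this
      omega
    · simp [y, h] at hm
  · have key := contraction_wedge X p z'
    rw [← koszulD_eq_contraction, ← koszulD_eq_contraction z', hd, ← hy] at key
    have h0 : wedge p (0 : Finset (Fin n) → MvPolynomial (Fin n) K) = 0 := by
      funext A; simp [wedge]
    rw [h0, add_zero, koszulD_eq_contraction, map_smul] at key
    funext A
    exact mul_left_cancel₀ (X_ne_zero p) (congrFun key A)

theorem support_modMonomial_single {p : Fin n} {f : MvPolynomial (Fin n) K} {m : Fin n →₀ ℕ}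
    (h : m ∈ (f.modMonomial (Finsupp.single p 1)).support) : m ∈ f.support ∧ m p = 0 := by
  rw [mem_support_iff, coeff_modMonomial_single] at h
  split_ifs at h with h'
  · exact ⟨mem_support_iff.2 h, h'⟩
  · exact absurd rfl h

/-- Variables are removed one at a time. Reduction modulo x_p and e_p only discards terms, so
freeness from earlier variables is preserved. -/
theorem exists_koszulD_sub_free {i j : ℕ} {z : Finset (Fin n) → MvPolynomial (Fin n) K}
    (hz : z ∈ koszulCycles ⊤ i j) (T : Finset (Fin n)) :
    ∃ y ∈ koszulChains (⊤ : Ideal (MvPolynomial (Fin n) K)) (i + 1) j,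
      z - koszulD K n y ∈ koszulCycles ⊤ i j ∧
      ∀ A, ∀ m ∈ ((z - koszulD K n y) A).support, ∀ p ∈ T, p ∉ A ∧ m p = 0 := by
  induction T using Finset.induction_on with
  | empty => exact ⟨0, zero_mem _, by simpa using hz, by simp⟩
  | insert p T _ ih =>
    obtain ⟨y, hy, hcyc, hfree⟩ := ih
    obtain ⟨y', hy', h'⟩ := exists_koszulD_eq_sub_dropVar p hcyc
    have heq : z - koszulD K n (y + y') = dropVar p (z - koszulD K n y) := by
      rw [map_add, h']; abel
    have hsupp : ∀ A, ∀ m ∈ (dropVar p (z - koszulD K n y) A).support,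
        p ∉ A ∧ m p = 0 ∧ m ∈ ((z - koszulD K n y) A).support := by
      intro A m hm
      simp only [dropVar] at hm
      split_ifs at hm with h
      · simp at hm
      · exact ⟨h, (support_modMonomial_single hm).2, (support_modMonomial_single hm).1⟩
    refine ⟨y + y', add_mem hy hy', ?_, ?_⟩
    · refine ⟨fun A => ⟨trivial, fun m hm => ?_⟩, ?_⟩
      · rw [heq] at hm
        exact (hcyc.1 A).2 m (hsupp A m hm).2.2
      · change koszulD K n _ = 0
        rw [map_sub, koszulD_koszulD, sub_zero]
        exact hz.2
    · rw [heq]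
      intro A m hm q hq
      rcases Finset.mem_insert.1 hq with rfl | hq
      · exact ⟨(hsupp A m hm).1, (hsupp A m hm).2.1⟩
      · exact hfree A m (hsupp A m hm).2.2 q hq

/-- The Koszul complex of the variables is a resolution of the residue field. -/
theorem koszulCycles_top_le {i j : ℕ} (hij : ¬(i = 0 ∧ j = 0)) :
    koszulCycles (⊤ : Ideal (MvPolynomial (Fin n) K)) i j ≤ koszulBoundaries ⊤ i j := by
  intro z hz
  obtain ⟨y, hy, hcyc, hfree⟩ := exists_koszulD_sub_free hz Finset.univ
  refine ⟨y, hy, ?_⟩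
  symm
  rw [← sub_eq_zero]
  funext A
  rw [Pi.zero_apply, ← support_eq_empty]
  refine Finset.eq_empty_of_forall_notMem fun m hm => hij ?_
  have hA : A = ∅ := Finset.eq_empty_of_forall_notMem fun p => (hfree A m hm p (by simp)).1
  have hm0 : m = 0 := Finsupp.ext fun p => (hfree A m hm p (by simp)).2
  have := (hcyc.1 A).2 m hm
  simp [hA, hm0] at this
  omega

end Exactness

/-! ### Degrees of the Koszul homology of a monomial ideal -/

section TaylorBound

variable {K : Type*} [Field K] {n : ℕ}

/-- Finiteness is essential for reading Betti numbers: `finrank` is 0 by default on an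
infinite-dimensional space. Only finitely many monomials have degree at most j. -/
instance finite_koszulChains (J : Ideal (MvPolynomial (Fin n) K)) (i j : ℕ) :
    Module.Finite K (koszulChains J i j) := by
  let D := {m : Fin n →₀ ℕ | m.degree ≤ j}
  have : Finite D := Finsupp.finite_of_degree_le j
  let φ : koszulChains J i j →ₗ[K] (Finset (Fin n) × D → K) :=
    { toFun := fun f x => coeff x.2.1 (f.1 x.1)
      map_add' := fun f g => by funext x; simp
      map_smul' := fun c f => by funext x; simp }
  refine Module.Finite.of_injective φ fun f g hfg => ?_
  ext A m
  by_cases hm : m.degree ≤ j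
  · exact congrFun hfg (A, ⟨m, hm⟩)
  · have hz : ∀ h : koszulChains J i j, coeff m (h.1 A) = 0 := fun h => by
      by_contra h0
      have := (h.2 A).2 m (mem_support_iff.2 h0)
      omega
    rw [hz, hz]

theorem gradedBetti_ne_zero_iff (J : Ideal (MvPolynomial (Fin n) K)) (i j : ℕ) :
    gradedBetti J i j ≠ 0 ↔ ¬ koszulCycles J i j ≤ koszulBoundaries J i j := by
  have : Module.Finite K (koszulCycles J i j) :=
    Submodule.finiteDimensional_inf_left (koszulChains J i j) _
  rw [not_iff_not, gradedBetti, Module.finrank_zero_iff, Submodule.Quotient.subsingleton_iff,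
    Submodule.submoduleOf_eq_top]

/-- The ideal generated by the monomials with exponents `v k`, `k ∈ s`. -/
def expIdeal (K : Type*) [Field K] {n : ℕ} {ι : Type*} (s : Finset ι) (v : ι → Fin n →₀ ℕ) :
    Ideal (MvPolynomial (Fin n) K) :=
  Ideal.span ((fun m => monomial m (1 : K)) '' (v '' s))

variable {ι : Type*}

theorem mem_expIdeal {s : Finset ι} {v : ι → Fin n →₀ ℕ} {f : MvPolynomial (Fin n) K} :
    f ∈ expIdeal K s v ↔ ∀ m ∈ f.support, ∃ k ∈ s, v k ≤ m := by
  rw [expIdeal, mem_ideal_span_monomial_image]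
  simp

theorem exists_coeff_eq_ite {σ : Type*} (P : (σ →₀ ℕ) → Prop) [DecidablePred P]
    (f : MvPolynomial σ K) : ∃ g : MvPolynomial σ K, ∀ m, coeff m g = if P m then coeff m f else 0 := by
  classical
  refine ⟨∑ m ∈ f.support.filter P, monomial m (coeff m f), fun m => ?_⟩
  simp only [coeff_sum, coeff_monomial, Finset.sum_ite_eq', Finset.mem_filter, mem_support_iff]
  by_cases h1 : P m <;> by_cases h2 : coeff m f = 0 <;> simp [h1, h2]

theorem koszulD_mem_koszulChains {J : Ideal (MvPolynomial (Fin n) K)} {i j : ℕ}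
    {f : Finset (Fin n) → MvPolynomial (Fin n) K} (hf : f ∈ koszulChains J (i + 1) j) :
    koszulD K n f ∈ koszulChains J i j := by
  intro B
  refine ⟨contraction_mem J (fun B p _ => J.mul_mem_left _ (hf (insert p B)).1) B, fun m hm => ?_⟩
  obtain ⟨p, hp, h⟩ : ∃ p ∈ Bᶜ, m ∈ ((-1) ^ (B.filter (· < p)).card *
      (X p * f (insert p B))).support := by
    by_contra! hcon
    rw [koszulD_eq_contraction, contraction_apply, mem_support_iff, coeff_sum] at hm
    exact hm (Finset.sum_eq_zero fun p hp => by simpa using hcon p hp)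
  have h' : m ∈ (X p * f (insert p B)).support := by
    rcases neg_one_pow_eq_or (MvPolynomial (Fin n) K) (B.filter (· < p)).card with e | e <;>
      simpa [e] using h
  rw [support_X_mul, Finset.mem_map] at h'
  obtain ⟨m', hm', rfl⟩ := h'
  have := (hf _).2 m' hm'
  rw [Finset.card_insert_of_notMem (by simpa using hp)] at this
  simp only [addLeftEmbedding_apply, map_add, Finsupp.degree_single]
  omega

theorem koszulD_eq_zero_of_card_eq_zero {J : Ideal (MvPolynomial (Fin n) K)} {j : ℕ}
    {f : Finset (Fin n) → MvPolynomial (Fin n) K} (hf : f ∈ koszulChains J 0 j) :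
    koszulD K n f = 0 := by
  funext B
  rw [koszulD_eq_contraction, contraction_apply]
  refine Finset.sum_eq_zero fun p _ => ?_
  have : f (insert p B) = 0 := by
    rw [← support_eq_empty]
    refine Finset.eq_empty_of_forall_notMem fun m hm => ?_
    have := ((hf _).2 m hm).1
    simp at this
  simp [this]

theorem koszulChains_mono {J J' : Ideal (MvPolynomial (Fin n) K)} (h : J ≤ J') (i j : ℕ) :
    koszulChains J i j ≤ koszulChains J' i j :=
  fun _ hf A => ⟨h (hf A).1, (hf A).2⟩

/-- Mayer-Vietoris: exactness for `J₁`, `J₂` and `J₁ ∩ J₂` gives exactness for `J₁ + J₂`. -/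
theorem koszulCycles_le_of_add {J J₁ J₂ J₁₂ : Ideal (MvPolynomial (Fin n) K)}
    (h₁ : J₁ ≤ J) (h₂ : J₂ ≤ J) (h₁₂ : J₁ ⊓ J₂ = J₁₂) {i j : ℕ}
    (hsplit : koszulChains J i j ≤ koszulChains J₁ i j ⊔ koszulChains J₂ i j)
    (e₁ : koszulCycles J₁ i j ≤ koszulBoundaries J₁ i j)
    (e₂ : koszulCycles J₂ i j ≤ koszulBoundaries J₂ i j)
    (e₁₂ : ∀ k, k + 1 = i → koszulCycles J₁₂ k j ≤ koszulBoundaries J₁₂ k j) :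
    koszulCycles J i j ≤ koszulBoundaries J i j := by
  rintro z ⟨hz, hdz⟩
  obtain ⟨z₁, hz₁, z₂, hz₂, rfl⟩ := Submodule.mem_sup.1 (hsplit hz)
  have hd : koszulD K n z₁ + koszulD K n z₂ = 0 := by rw [← map_add]; exact hdz
  -- The connecting map: dz₁ = -dz₂ is a cycle over J₁ ∩ J₂, and a chain w over the intersection
  -- with dw = dz₁ turns z₁ - w and z₂ + w into cycles over J₁ and J₂.
  obtain ⟨w, hw₁, hw₂, hdw⟩ : ∃ w, w ∈ koszulChains J₁ i j ∧ w ∈ koszulChains J₂ i j ∧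
      koszulD K n w = koszulD K n z₁ := by
    rcases i with _ | k
    · exact ⟨0, zero_mem _, zero_mem _, by rw [map_zero, koszulD_eq_zero_of_card_eq_zero hz₁]⟩
    · have hc : koszulD K n z₁ ∈ koszulCycles J₁₂ k j := by
        refine ⟨fun A => ⟨?_, (koszulD_mem_koszulChains hz₁ A).2⟩, koszulD_koszulD z₁⟩
        rw [← h₁₂]
        refine ⟨(koszulD_mem_koszulChains hz₁ A).1, ?_⟩
        rw [eq_neg_of_add_eq_zero_left hd]
        exact neg_mem (koszulD_mem_koszulChains hz₂ A).1
      obtain ⟨w, hw, hdw⟩ := e₁₂ k rfl hc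
      exact ⟨w, koszulChains_mono (h₁₂ ▸ inf_le_left) _ _ hw,
        koszulChains_mono (h₁₂ ▸ inf_le_right) _ _ hw, hdw⟩
  obtain ⟨y₁, hy₁, hdy₁⟩ := e₁ ⟨sub_mem hz₁ hw₁, show koszulD K n _ = 0 by
    rw [map_sub, hdw, sub_self]⟩
  obtain ⟨y₂, hy₂, hdy₂⟩ := e₂ ⟨add_mem hz₂ hw₂, show koszulD K n _ = 0 by
    rw [map_add, hdw, add_comm, hd]⟩
  refine ⟨y₁ + y₂, add_mem (koszulChains_mono h₁ _ _ hy₁) (koszulChains_mono h₂ _ _ hy₂), ?_⟩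
  rw [map_add, hdy₁, hdy₂]
  abel

/-- A principal ideal is a copy of S shifted by the degree of its generator, so its homology is
confined to that one degree. -/
theorem koszulCycles_singleton_le {k : ι} {v : ι → Fin n →₀ ℕ} {i j : ℕ}
    (hij : ¬(i = 0 ∧ j = (v k).degree)) :
    koszulCycles (expIdeal K {k} v) i j ≤ koszulBoundaries (expIdeal K {k} v) i j := by
  rintro z ⟨hz, hdz⟩
  have hdvd : ∀ A, ∃ f, z A = monomial (v k) 1 * f := fun A => by
    have := (hz A).1
    simp only [expIdeal, Finset.coe_singleton, Set.image_singleton,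
      Ideal.mem_span_singleton] at this
    exact this
  choose z' hz' using hdvd
  have hzz : z = (monomial (v k) (1 : K)) • z' := funext hz'
  have hmono : (monomial (v k) (1 : K)) ≠ 0 := by simp
  have hsupp : ∀ A, ∀ m ∈ (z' A).support, A.card = i ∧ (v k).degree + m.degree + A.card = j := by
    intro A m hm
    have := (hz A).2 (v k + m) (by
      rw [hz', mem_support_iff, coeff_monomial_mul, one_mul]
      exact mem_support_iff.1 hm)
    rwa [map_add] at this
  have hcyc : z' ∈ koszulCycles ⊤ i (j - (v k).degree) := by
    refine ⟨fun A => ⟨trivial, fun m hm => ?_⟩, ?_⟩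
    · have := hsupp A m hm
      omega
    · have h0 : koszulD K n z = 0 := hdz
      rw [hzz, koszulD_eq_contraction, map_smul] at h0
      funext A
      exact (mul_eq_zero.1 (congrFun h0 A)).resolve_left hmono
  -- The subtraction in `hcyc` is truncated; below the degree of the generator the strand is zero.
  by_cases hj : (v k).degree ≤ j
  · obtain ⟨y, hy, hdy⟩ := koszulCycles_top_le (by omega) hcyc
    refine ⟨(monomial (v k) (1 : K)) • y, fun A => ⟨?_, fun m hm => ?_⟩, ?_⟩
    · exact Ideal.mul_mem_right _ _ (Ideal.subset_span (by simp))
    · rw [Pi.smul_apply, smul_eq_mul, mem_support_iff, coeff_monomial_mul', one_mul] at hm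
      split_ifs at hm with hle
      · have := (hy A).2 _ (mem_support_iff.2 hm)
        have hdeg : m.degree = (m - v k).degree + (v k).degree := by
          rw [← map_add, tsub_add_cancel_of_le hle]
        omega
      · exact absurd rfl hm
    · rw [koszulD_eq_contraction, map_smul, ← koszulD_eq_contraction, hdy, hzz]
  · have h0 : z' = 0 := by
      funext A
      rw [Pi.zero_apply, ← support_eq_empty]
      refine Finset.eq_empty_of_forall_notMem fun m hm => ?_
      have := hsupp A m hm
      omega
    rw [hzz, h0, smul_zero]
    exact zero_mem _

/-- Nonzero graded Betti numbers of a monomial ideal occur in the degrees of the Taylor complex. -/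
theorem exists_degree_sup_eq_of_not_le [DecidableEq ι] (s : Finset ι) (v : ι → Fin n →₀ ℕ) {i j : ℕ}
    (h : ¬ koszulCycles (expIdeal K s v) i j ≤ koszulBoundaries (expIdeal K s v) i j) :
    ∃ F ⊆ s, F.card = i + 1 ∧ (F.sup v).degree = j := by
  induction s using Finset.induction_on generalizing v i j with
  | empty =>
    refine absurd ?_ h
    intro z hz
    have : z = 0 := by
      funext A
      rw [Pi.zero_apply, ← support_eq_empty]
      refine Finset.eq_empty_of_forall_notMem fun m hm => ?_
      obtain ⟨k, hk, _⟩ := mem_expIdeal.1 (hz.1 A).1 m hm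
      simp at hk
    rw [this]
    exact zero_mem _
  | insert a s ha ih =>
    by_contra! hcon
    apply h
    -- The intersection with the new principal ideal is generated by the lcms with the new
    -- generator, so the induction must range over all families `v`.
    refine koszulCycles_le_of_add (J₁ := expIdeal K s v) (J₂ := expIdeal K {a} v)
      (J₁₂ := expIdeal K s fun k => v k ⊔ v a) ?_ ?_ ?_ ?_ ?_ ?_ ?_
    · intro f hf
      rw [mem_expIdeal] at hf ⊢
      intro m hm
      obtain ⟨k, hk, hkm⟩ := hf m hm
      exact ⟨k, Finset.mem_insert_of_mem hk, hkm⟩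
    · intro f hf
      rw [mem_expIdeal] at hf ⊢
      intro m hm
      obtain ⟨k, hk, hkm⟩ := hf m hm
      exact ⟨k, by simp at hk; simp [hk], hkm⟩
    · ext f
      rw [Submodule.mem_inf, mem_expIdeal, mem_expIdeal, mem_expIdeal, ← forall₂_and]
      refine forall₂_congr fun m _ => ?_
      simp only [Finset.mem_singleton, exists_eq_left, sup_le_iff]
      constructor
      · rintro ⟨⟨k, hk, hkm⟩, ham⟩
        exact ⟨k, hk, hkm, ham⟩
      · rintro ⟨k, hk, hkm, ham⟩
        exact ⟨⟨k, hk, hkm⟩, ham⟩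
    · classical
      intro z hz
      -- Split each coefficient by monomials: those divisible by an old generator go to z₁, and the
      -- others must be divisible by the new one.
      choose z₁ hz₁ using fun A => exists_coeff_eq_ite (fun m => ∃ k ∈ s, v k ≤ m) (z A)
      rw [Submodule.mem_sup]
      have hs₁ : ∀ A, ∀ m ∈ (z₁ A).support, (∃ k ∈ s, v k ≤ m) ∧ m ∈ (z A).support := by
        intro A m hm
        rw [mem_support_iff, hz₁] at hm
        split_ifs at hm with hP
        · exact ⟨hP, mem_support_iff.2 hm⟩
        · exact absurd rfl hm
      have hs₂ : ∀ A, ∀ m ∈ ((z - z₁) A).support, (¬ ∃ k ∈ s, v k ≤ m) ∧ m ∈ (z A).support := by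
        intro A m hm
        rw [Pi.sub_apply, mem_support_iff, coeff_sub, hz₁] at hm
        split_ifs at hm with hP
        · exact absurd (sub_self _) hm
        · exact ⟨hP, mem_support_iff.2 (by rwa [sub_zero] at hm)⟩
      refine ⟨z₁, fun A => ⟨mem_expIdeal.2 fun m hm => (hs₁ A m hm).1,
        fun m hm => (hz A).2 m (hs₁ A m hm).2⟩, z - z₁,
        fun A => ⟨mem_expIdeal.2 fun m hm => ?_, fun m hm => (hz A).2 m (hs₂ A m hm).2⟩, by abel⟩
      obtain ⟨hP, hmz⟩ := hs₂ A m hm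
      obtain ⟨k, hk, hkm⟩ := mem_expIdeal.1 (hz A).1 m hmz
      rcases Finset.mem_insert.1 hk with rfl | hk
      · exact ⟨k, Finset.mem_singleton_self k, hkm⟩
      · exact absurd ⟨k, hk, hkm⟩ hP
    · by_contra h'
      obtain ⟨F, hF, hc, hd⟩ := ih v h'
      exact hcon F (hF.trans (Finset.subset_insert _ _)) hc hd
    · refine koszulCycles_singleton_le fun hij => ?_
      exact hcon {a} (by simp) (by simp [hij.1]) (by simp [hij.2])
    · rintro k rfl
      by_contra h'
      obtain ⟨F, hF, hc, hd⟩ := ih _ h'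
      refine hcon (insert a F) (Finset.insert_subset_insert _ hF) ?_ ?_
      · rw [Finset.card_insert_of_notMem fun h => ha (hF h), hc]
      -- Nonemptiness of F ensures that the lcm of the modified family already includes `v a`; over
      -- the empty set it would be 1.
      · have hF' : F.Nonempty := Finset.card_pos.1 (by omega)
        have hsup : F.sup (fun k => v k ⊔ v a) = F.sup v ⊔ v a :=
          Finset.sup_sup.trans (by rw [Finset.sup_const hF'])
        rw [← hd, Finset.sup_insert, hsup, sup_comm]

end TaylorBound

/-! ### Initial degree and upper bound for the gradient ideal -/

section GradientBounds

variable {K : Type*} [Field K] {n : ℕ} {I : Ideal (MvPolynomial (Fin n) K)}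

theorem mem_minGens {a : Fin n →₀ ℕ} :
    a ∈ minGens I ↔ Minimal (fun b => monomial b (1 : K) ∈ I) a := by
  simp [minGens, minGenSet]

theorem IsMonomialIdeal.eq_expIdeal (hI : IsMonomialIdeal I) :
    I = expIdeal K (minGens I) id := by
  obtain ⟨A, hA⟩ := hI
  ext f
  rw [mem_expIdeal]
  have hmono : ∀ m, monomial m (1 : K) ∈ I ↔ ∃ a ∈ A, a ≤ m := fun m => by
    rw [hA, mem_ideal_span_monomial_image]
    simp
  have hf : f ∈ I ↔ ∀ m ∈ f.support, monomial m (1 : K) ∈ I := by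
    simp only [hmono]
    rw [hA, mem_ideal_span_monomial_image]
  rw [hf]
  refine forall₂_congr fun m _ => ⟨fun hm => ?_, ?_⟩
  · obtain ⟨a, ham, ha⟩ := exists_minimal_le_of_wellFoundedLT
      (fun b => monomial b (1 : K) ∈ I) m hm
    exact ⟨a, mem_minGens.2 ha, ham⟩
  · rintro ⟨a, ha, ham⟩
    obtain ⟨b, hb, hba⟩ := (hmono a).1 (mem_minGens.1 ha).1
    exact (hmono m).2 ⟨b, hb, hba.trans ham⟩

theorem degree_ne_zero_of_mem_minGens (htop : I ≠ ⊤) {a : Fin n →₀ ℕ} (ha : a ∈ minGens I) :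
    a.degree ≠ 0 := by
  intro h
  rw [Finsupp.degree_eq_zero_iff] at h
  subst h
  exact htop ((Ideal.eq_top_iff_one _).2 (mem_minGens.1 ha).1)

theorem exists_X_mem_of_degree_eq_one {a : Fin n →₀ ℕ} (ha : a ∈ minGens I)
    (h : a.degree = 1) : ∃ i, a = Finsupp.single i 1 ∧ X i ∈ I := by
  have hne : a ≠ 0 := by rintro rfl; simp at h
  obtain ⟨i, hi⟩ := Finsupp.support_nonempty_iff.2 hne
  have hle : Finsupp.single i 1 ≤ a :=
    Finsupp.single_le_iff.2 (Nat.one_le_iff_ne_zero.2 (Finsupp.mem_support_iff.1 hi))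
  have heq : a = Finsupp.single i 1 := by
    have h1 : a - Finsupp.single i 1 + Finsupp.single i 1 = a := tsub_add_cancel_of_le hle
    have h2 := congrArg Finsupp.degree h1
    rw [map_add, Finsupp.degree_single, h, Nat.add_eq_right, Finsupp.degree_eq_zero_iff] at h2
    rw [h2, zero_add] at h1
    exact h1.symm
  refine ⟨i, heq, ?_⟩
  have := (mem_minGens.1 ha).1
  rwa [heq] at this

/-- The indices of the generators `u / xᵢ` of the gradient ideal. -/
def gradientIndex (I : Ideal (MvPolynomial (Fin n) K)) : Finset (Σ _ : Fin n →₀ ℕ, Fin n) :=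
  (minGens I).sigma fun a => a.support

/-- The exponent of `u / xᵢ`. -/
def gradientExp (x : Σ _ : Fin n →₀ ℕ, Fin n) : Fin n →₀ ℕ := x.1 - Finsupp.single x.2 1

theorem starGradientIdeal_eq_expIdeal (I : Ideal (MvPolynomial (Fin n) K)) :
    starGradientIdeal I = expIdeal K (gradientIndex I) gradientExp := by
  rw [starGradientIdeal, expIdeal]
  congr 1
  ext f
  simp only [Set.mem_ofPred_eq, Set.mem_image, exists_exists_and_eq_and, Finset.mem_coe,
    gradientIndex, Finset.mem_sigma, gradientExp]
  constructor
  · rintro ⟨a, ha, i, hi, rfl⟩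
    exact ⟨⟨a, i⟩, ⟨ha, hi⟩, rfl⟩
  · rintro ⟨⟨a, i⟩, ⟨ha, hi⟩, rfl⟩
    exact ⟨a, ha, i, hi, rfl⟩

theorem single_le_of_mem_support {a : Fin n →₀ ℕ} {i : Fin n} (hi : i ∈ a.support) :
    Finsupp.single i 1 ≤ a :=
  Finsupp.single_le_iff.2 (Nat.one_le_iff_ne_zero.2 (Finsupp.mem_support_iff.1 hi))

theorem degree_gradientExp_add_one {a : Fin n →₀ ℕ} {i : Fin n} (hi : i ∈ a.support) :
    (gradientExp ⟨a, i⟩).degree + 1 = a.degree := by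
  conv_rhs => rw [← tsub_add_cancel_of_le (single_le_of_mem_support hi)]
  rw [map_add, Finsupp.degree_single]
  rfl

theorem bddAbove_regSet_expIdeal {ι : Type*} (s : Finset ι) (v : ι → Fin n →₀ ℕ) :
    BddAbove (regSet (expIdeal K s v)) := by
  classical
  refine ⟨((s.sup v).degree : ℤ), ?_⟩
  rintro _ ⟨i, j, h, rfl⟩
  obtain ⟨F, hF, -, hj⟩ := exists_degree_sup_eq_of_not_le s v ((gradedBetti_ne_zero_iff _ _ _).1 h)
  have : (F.sup v).degree ≤ (s.sup v).degree := Finsupp.degree_mono (Finset.sup_mono hF)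
  omega

theorem eq_zero_of_mem_regSet_top {r : ℤ}
    (hr : r ∈ regSet (⊤ : Ideal (MvPolynomial (Fin n) K))) : r = 0 := by
  obtain ⟨i, j, h, rfl⟩ := hr
  rw [gradedBetti_ne_zero_iff] at h
  by_contra h0
  exact h (koszulCycles_top_le (by omega))

theorem exists_minGens_degree_le (hI : IsMonomialIdeal I) (hbot : I ≠ ⊥) :
    ∃ a ∈ minGens I, ∀ b ∈ minGens I, a.degree ≤ b.degree := by
  refine Finset.exists_min_image (minGens I) _ ?_
  by_contra h
  rw [Finset.not_nonempty_iff_eq_empty] at h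
  apply hbot
  rw [hI.eq_expIdeal, h, expIdeal]
  simp

/-- The cycle u/x_i lies in the lowest degree of the ideal. A chain bounding it would need
coefficients of one degree less, and there are none. -/
theorem degree_sub_one_mem_regSet (htop : I ≠ ⊤) {a : Fin n →₀ ℕ} (ha : a ∈ minGens I)
    (hmin : ∀ b ∈ minGens I, a.degree ≤ b.degree) :
    (a.degree : ℤ) - 1 ∈ regSet (starGradientIdeal I) := by
  have hpos := degree_ne_zero_of_mem_minGens htop ha
  obtain ⟨i, hi⟩ : a.support.Nonempty := by
    rw [Finsupp.support_nonempty_iff]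
    rintro rfl
    simp at hpos
  have hdeg := degree_gradientExp_add_one hi
  refine ⟨0, a.degree - 1, ?_, by push_cast [Nat.one_le_iff_ne_zero.2 hpos]; ring⟩
  rw [gradedBetti_ne_zero_iff, starGradientIdeal_eq_expIdeal]
  intro hle
  let z : Finset (Fin n) → MvPolynomial (Fin n) K :=
    Pi.single ∅ (monomial (gradientExp ⟨a, i⟩) 1)
  have hz : z ∈ koszulChains (expIdeal K (gradientIndex I) gradientExp) 0 (a.degree - 1) := by
    intro A
    by_cases hA : A = ∅
    · subst hA
      simp only [z, Pi.single_eq_same]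
      refine ⟨Ideal.subset_span ⟨_, ⟨⟨a, i⟩, ?_, rfl⟩, rfl⟩, fun m hm => ?_⟩
      · simp only [gradientIndex, Finset.coe_sigma, Set.mem_sigma_iff, Finset.mem_coe]
        exact ⟨ha, hi⟩
      · have hm' := Finset.mem_singleton.1 (support_monomial_subset hm)
        subst hm'
        simp only [Finset.card_empty, true_and]
        omega
    · simp [z, hA]
  obtain ⟨y, hy, hdy⟩ := hle ⟨hz, koszulD_eq_zero_of_card_eq_zero hz⟩
  have hy0 : y = 0 := by
    funext A
    rw [Pi.zero_apply, ← support_eq_empty]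
    refine Finset.eq_empty_of_forall_notMem fun m hm => ?_
    obtain ⟨⟨b, p⟩, hb, hbm⟩ := mem_expIdeal.1 (hy A).1 m hm
    simp only [gradientIndex, Finset.mem_sigma] at hb
    have h1 := degree_gradientExp_add_one hb.2
    have h2 := Finsupp.degree_mono hbm
    have h3 := (hy A).2 m hm
    have h4 := hmin b hb.1
    omega
  rw [hy0, map_zero] at hdy
  have := congrFun hdy ∅
  simp only [z, Pi.single_eq_same, Pi.zero_apply] at this
  exact one_ne_zero (monomial_eq_zero.1 this.symm)

theorem initialDegree_le (hI : IsMonomialIdeal I) {a : Fin n →₀ ℕ} (ha : a ∈ minGens I) :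
    initialDegree I ≤ a.degree := by
  refine Nat.sInf_le ⟨monomial a 1, (mem_minGens.1 ha).1, isHomogeneous_monomial 1 rfl, ?_⟩
  -- 𝔪I is generated by the x_i x^b with b a minimal exponent. If one of these divided x^a,
  -- minimality would give a ≤ b, contradicting the degrees.
  have hle : irrelevantIdeal K n * I ≤ expIdeal K (Finset.univ ×ˢ minGens I)
      (fun x : Fin n × (Fin n →₀ ℕ) => x.2 + Finsupp.single x.1 1) := by
    conv_lhs => rw [hI.eq_expIdeal]
    rw [irrelevantIdeal, expIdeal, Ideal.span_mul_span', Ideal.span_le]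
    rintro _ ⟨_, ⟨i, rfl⟩, _, ⟨_, ⟨b, hb, rfl⟩, rfl⟩, rfl⟩
    refine Ideal.subset_span ⟨b + Finsupp.single i 1, ⟨(i, b), by simpa using hb, rfl⟩, ?_⟩
    simp only [X, monomial_mul, one_mul, id, add_comm b]
  intro hmem
  obtain ⟨⟨i, b⟩, hb, hba⟩ := mem_expIdeal.1 (hle hmem) a (by simp)
  simp only [Finset.mem_product, Finset.mem_univ, true_and] at hb
  have hba' : b ≤ a := le_self_add.trans hba
  have hab := (mem_minGens.1 ha).2 (mem_minGens.1 hb).1 hba'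
  have h1 : (b + Finsupp.single i 1).degree ≤ a.degree := Finsupp.degree_mono hba
  have h2 : a.degree ≤ b.degree := Finsupp.degree_mono hab
  rw [map_add, Finsupp.degree_single] at h1
  omega

/-- Three cases for the size of F: at least two, where the lcm still divides x^a; one, where its
degree is deg a - 1; zero, the case that uses deg a ≥ 2. -/
theorem degree_sup_fiber_le {a : Fin n →₀ ℕ} (h2 : 2 ≤ a.degree)
    {F : Finset (Σ _ : Fin n →₀ ℕ, Fin n)} (hF : ∀ x ∈ F, x.1 = a ∧ x.2 ∈ a.support) :
    (F.sup gradientExp).degree + 2 ≤ a.degree + F.card := by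
  rcases Nat.lt_or_ge 1 F.card with h | h
  · have : F.sup gradientExp ≤ a := Finset.sup_le fun x hx => by
      rw [gradientExp, (hF x hx).1]
      exact tsub_le_self
    have := Finsupp.degree_mono this
    omega
  · have : Nonempty (Σ _ : Fin n →₀ ℕ, Fin n) := by
      by_contra hne
      rw [not_nonempty_iff] at hne
      have : a = 0 := by
        ext i
        exact (hne.false ⟨a, i⟩).elim
      simp [this] at h2
    rcases Finset.card_le_one_iff_subset_singleton.1 h with ⟨x, hx⟩
    rcases Finset.subset_singleton_iff.1 hx with rfl | rfl
    · rw [Finset.sup_empty, Finset.card_empty, show (⊥ : Fin n →₀ ℕ) = 0 from rfl, map_zero]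
      omega
    · obtain ⟨h3, h4⟩ := hF x (by simp)
      obtain ⟨b, i⟩ := x
      simp only at h3 h4
      subst h3
      have := degree_gradientExp_add_one h4
      rw [Finset.sup_singleton, Finset.card_singleton]
      omega

theorem degree_sup_gradientExp_le (G : Finset (Fin n →₀ ℕ)) (h2 : ∀ a ∈ G, 2 ≤ a.degree)
    {F : Finset (Σ _ : Fin n →₀ ℕ, Fin n)} (hF : ∀ x ∈ F, x.1 ∈ G ∧ x.2 ∈ x.1.support) :
    (F.sup gradientExp).degree + G.card * 2 ≤ ∑ a ∈ G, a.degree + F.card := by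
  let c : (Fin n →₀ ℕ) → Finset (Σ _ : Fin n →₀ ℕ, Fin n) := fun a => F.filter (·.1 = a)
  -- The lcm of F divides the product of the lcms of its fibres.
  have hsup : F.sup gradientExp ≤ ∑ a ∈ G, (c a).sup gradientExp := by
    refine Finset.sup_le fun x hx => ?_
    have h3 : gradientExp x ≤ (c x.1).sup gradientExp :=
      Finset.le_sup (Finset.mem_filter.2 ⟨hx, rfl⟩)
    rw [← Finset.add_sum_erase _ _ (hF x hx).1]
    exact h3.trans le_self_add
  have hc : F.card = ∑ a ∈ G, (c a).card := by
    rw [Finset.card_eq_sum_ones, ← Finset.sum_fiberwise_of_maps_to fun x hx => (hF x hx).1]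
    simp only [c, Finset.card_eq_sum_ones]
  have hd : (F.sup gradientExp).degree ≤ ∑ a ∈ G, ((c a).sup gradientExp).degree :=
    (Finsupp.degree_mono hsup).trans (map_sum _ _ _).le
  have hs : ∑ a ∈ G, (((c a).sup gradientExp).degree + 2) ≤ ∑ a ∈ G, (a.degree + (c a).card) := by
    refine Finset.sum_le_sum fun a ha => degree_sup_fiber_le (h2 a ha) fun x hx => ?_
    obtain ⟨h3, h4⟩ := Finset.mem_filter.1 hx
    exact ⟨h4, h4 ▸ (hF x h3).2⟩
  rw [Finset.sum_add_distrib, Finset.sum_add_distrib, ← hc, Finset.sum_const, smul_eq_mul] at hs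
  exact (Nat.add_le_add_right hd _).trans hs

theorem le_of_mem_regSet_starGradientIdeal (h2 : ∀ a ∈ minGens I, 2 ≤ a.degree) {r : ℤ}
    (hr : r ∈ regSet (starGradientIdeal I)) :
    r ≤ (∑ a ∈ minGens I, (a.degree : ℤ)) - 2 * ((minGens I).card : ℤ) + 1 := by
  classical
  obtain ⟨i, j, h, rfl⟩ := hr
  rw [gradedBetti_ne_zero_iff, starGradientIdeal_eq_expIdeal] at h
  obtain ⟨F, hF, hcard, hdeg⟩ := exists_degree_sup_eq_of_not_le _ _ h
  have key := degree_sup_gradientExp_le (minGens I) h2 (F := F) fun x hx =>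
    Finset.mem_sigma.1 (hF hx)
  rw [hdeg, hcard] at key
  rw [← Nat.cast_sum]
  omega

theorem starGradientIdeal_eq_top {i : Fin n} (h : Finsupp.single i 1 ∈ minGens I) :
    starGradientIdeal I = ⊤ := by
  rw [Ideal.eq_top_iff_one]
  exact Ideal.subset_span ⟨_, h, i, by simp, by simp⟩

end GradientBounds

/-! ### Iterated contractions -/

section IteratedContraction

variable {R : Type*} [CommRing R] {n : ℕ}

/-- The composite of the contractions with the forms of a list; the last form acts first. -/
def contractions : List (Fin n → R) → (Finset (Fin n) → R) →ₗ[R] (Finset (Fin n) → R)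
  | [] => LinearMap.id
  | g :: L => contraction g ∘ₗ contractions L

theorem contractions_cons (g : Fin n → R) (L : List (Fin n → R)) (f : Finset (Fin n) → R) :
    contractions (g :: L) f = contraction g (contractions L f) := rfl

theorem contractions_append (L L' : List (Fin n → R)) (f : Finset (Fin n) → R) :
    contractions (L ++ L') f = contractions L (contractions L' f) := by
  induction L with
  | nil => rfl
  | cons g L ih => rw [List.cons_append, contractions_cons, contractions_cons, ih]

theorem contractions_contraction (L : List (Fin n → R)) (g : Fin n → R)
    (f : Finset (Fin n) → R) :
    contractions L (contraction g f) = (-1 : R) ^ L.length • contraction g (contractions L f) := by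
  induction L with
  | nil => simp [contractions]
  | cons h L ih =>
    rw [contractions_cons, ih, map_smul, contraction_anticomm, contractions_cons, List.length_cons,
      pow_succ, mul_smul, neg_one_smul]

/-- Up to sign the contraction with g moves through the list until it meets its other copy, and its
square is zero. -/
theorem contractions_contraction_of_mem {L : List (Fin n → R)} {g : Fin n → R} (hg : g ∈ L)
    (f : Finset (Fin n) → R) : contractions L (contraction g f) = 0 := by
  induction L with
  | nil => simp at hg
  | cons h L ih =>
    rw [contractions_cons]
    rcases List.mem_cons.1 hg with rfl | hg
    · rw [contractions_contraction, map_smul, contraction_contraction_self, smul_zero]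
    · rw [ih hg, map_zero]

theorem contractions_mem (Q : Ideal R) (L : List (Fin n → R)) {f : Finset (Fin n) → R}
    (h : ∀ B, f B ∈ Q) (B : Finset (Fin n)) : contractions L f B ∈ Q := by
  induction L generalizing B with
  | nil => exact h B
  | cons g L ih => exact contraction_mem Q (fun B p _ => Q.mul_mem_left _ (ih _)) B

theorem contraction_zero_left (f : Finset (Fin n) → R) : contraction 0 f = 0 := by
  funext B
  simp [contraction_apply]

theorem contraction_sum {ι : Type*} (s : Finset ι) (g : ι → Fin n → R) (f : Finset (Fin n) → R) :
    contraction (∑ a ∈ s, g a) f = ∑ a ∈ s, contraction (g a) f := by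
  classical
  induction s using Finset.induction_on with
  | empty => simp [contraction_zero_left]
  | insert a s ha ih => rw [Finset.sum_insert ha, Finset.sum_insert ha, contraction_add, ih]

end IteratedContraction

/-! ### Detecting forms for the generators -/

section LowerBound

variable {K : Type*} [Field K] {n : ℕ}

/-- The part of the Koszul form `∑ x_p e_p^*` that is supported on `s`. -/
def varForm (K : Type*) [Field K] {n : ℕ} (s : Finset (Fin n)) : Fin n → MvPolynomial (Fin n) K :=
  fun p => if p ∈ s then X p else 0

theorem varForm_union {s t : Finset (Fin n)} (h : Disjoint s t) :
    varForm K (s ∪ t) = varForm K s + varForm K t := by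
  funext p
  simp only [varForm, Pi.add_apply, Finset.mem_union]
  by_cases hs : p ∈ s
  · simp [hs, Finset.disjoint_left.1 h hs]
  · simp [hs]

/-- The exponent of the squarefree monomial `∏_{p ∈ A} x_p`. -/
def indExp (A : Finset (Fin n)) : Fin n →₀ ℕ := ∑ p ∈ A, Finsupp.single p 1

/-- A multidegree `c + indExp A` and a list of linear forms that detect a top nonzero class in the
Koszul homology of the gradient ideal of the single monomial `x^a`. -/
structure Detects (K : Type*) [Field K] {n : ℕ} (a : Fin n →₀ ℕ) (A : Finset (Fin n))
    (c : Fin n →₀ ℕ) (L : List (Fin n → MvPolynomial (Fin n) K))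
    (Q : Ideal (MvPolynomial (Fin n) K)) : Prop where
  nonempty : A.Nonempty
  subset : A ⊆ a.support
  degree_add : c.degree + 2 = a.degree
  le : c + indExp A ≤ a
  exists_eq : ∀ p ∈ A, ∃ i ∈ a.support, c + Finsupp.single p 1 = a - Finsupp.single i 1
  mem_list : varForm K a.support ∈ L
  mem_ideal : ∀ f B, contractions L f B ∈ Q
  exists_lt : ∀ q ∈ Q, ∀ m ∈ q.support, ∀ i ∈ a.support,
    ∃ p ∈ a.support, (c + indExp A) p < (a - Finsupp.single i 1 + m : Fin n →₀ ℕ) p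
  apply_single : ∀ B, Disjoint B a.support → ∀ r, ∃ k : ℕ,
    contractions L (Pi.single (B ∪ A) r) = Pi.single B ((-1) ^ k * (monomial (indExp A) 1 * r))

/-- For u = x^k the gradient ideal is (x^(k-1)), which is also the detecting monomial. Contraction
contributes another factor x, so an element of the ideal overshoots. -/
theorem detects_of_support_eq_singleton {a : Fin n →₀ ℕ} (h2 : 2 ≤ a.degree) {x : Fin n}
    (hx : a.support = {x}) :
    Detects K a {x} (a - Finsupp.single x 2) [varForm K a.support] (Ideal.span {X x}) := by
  have ha : a = Finsupp.single x (a x) := Finsupp.support_subset_singleton.1 hx.subset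
  have hax : 2 ≤ a x := by
    rw [ha, Finsupp.degree_single] at h2
    exact h2
  have hle : Finsupp.single x 2 ≤ a := Finsupp.single_le_iff.2 hax
  have hc : a - Finsupp.single x 2 + Finsupp.single x 1 = a - Finsupp.single x 1 := by
    ext q
    by_cases hq : q = x
    · subst hq
      simp
      omega
    · simp [Finsupp.single_eq_of_ne hq]
  refine ⟨by simp, hx.symm.subset, ?_, ?_, ?_, by simp, ?_, ?_, ?_⟩
  · conv_rhs => rw [← tsub_add_cancel_of_le hle]
    rw [map_add, Finsupp.degree_single]
  · simp only [indExp, Finset.sum_singleton]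
    rw [hc]
    exact tsub_le_self
  · intro p hp
    rw [Finset.mem_singleton] at hp
    subst hp
    exact ⟨p, by simp [hx], hc⟩
  · intro f B
    refine contraction_mem _ (fun B p _ => Ideal.mul_mem_right _ _ ?_) B
    rw [hx, varForm]
    split_ifs with hp
    · rw [Finset.mem_singleton] at hp
      subst hp
      exact Ideal.mem_span_singleton_self _
    · exact zero_mem _
  · intro q hq m hm i hi
    have hq' : q ∈ Ideal.span (X '' {x}) := by rwa [Set.image_singleton]
    obtain ⟨p, hp, hpm⟩ := mem_ideal_span_X_image.1 hq' m hm
    rw [Set.mem_singleton_iff] at hp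
    rw [hx, Finset.mem_singleton] at hi
    subst hp hi
    refine ⟨i, by simp [hx], ?_⟩
    simp only [indExp, Finset.sum_singleton]
    rw [hc, Finsupp.add_apply]
    omega
  · intro B hB r
    rw [hx, Finset.disjoint_singleton_right] at hB
    refine ⟨(B.filter (· < x)).card, ?_⟩
    rw [contractions_cons]
    change contraction _ (Pi.single (B ∪ {x}) r) = _
    rw [Finset.union_comm, ← Finset.insert_eq, contraction_single hB]
    · simp [varForm, hx, indExp, X]
    · intro q hq
      rw [varForm, if_neg]
      rw [hx, Finset.mem_singleton]
      rintro rfl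
      exact hB hq

/-- Here the detecting monomial is u itself. Contracting with x e_x^* and with the whole support
gives coefficients in the ideal of the x x_q with q ≠ x. Multiplied by u/x_i, such a product exceeds
u at x if i ≠ x, and at q if i = x. -/
theorem detects_of_ne {a : Fin n →₀ ℕ} {x y : Fin n} (hx : x ∈ a.support) (hy : y ∈ a.support)
    (hxy : x ≠ y) :
    Detects K a {x, y} (a - Finsupp.single x 1 - Finsupp.single y 1)
      [varForm K a.support, varForm K {x}]
      (Ideal.span ((fun m => monomial m (1 : K)) ''
        {m | ∃ q ∈ a.support, q ≠ x ∧ m = Finsupp.single x 1 + Finsupp.single q 1})) := by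
  have hlex := single_le_of_mem_support hx
  have hley : Finsupp.single y 1 ≤ a - Finsupp.single x 1 := by
    rw [Finsupp.single_le_iff, Finsupp.tsub_apply, Finsupp.single_eq_of_ne hxy.symm]
    have := Finsupp.mem_support_iff.1 hy
    omega
  have hcy : a - Finsupp.single x 1 - Finsupp.single y 1 + Finsupp.single y 1 =
      a - Finsupp.single x 1 := tsub_add_cancel_of_le hley
  have hind : indExp {x, y} = Finsupp.single x 1 + Finsupp.single y 1 := by
    rw [indExp, Finset.sum_pair hxy]
  have htot : a - Finsupp.single x 1 - Finsupp.single y 1 + indExp {x, y} = a := by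
    rw [hind, add_comm (Finsupp.single x 1), ← add_assoc, hcy, tsub_add_cancel_of_le hlex]
  refine ⟨by simp, by simp [Finset.insert_subset_iff, Finsupp.mem_support_iff.1 hx,
    Finsupp.mem_support_iff.1 hy], ?_, htot.le, ?_, by simp, ?_, ?_, ?_⟩
  · conv_rhs => rw [← htot, hind]
    rw [map_add, map_add, Finsupp.degree_single, Finsupp.degree_single]
  · intro p hp
    rcases Finset.mem_insert.1 hp with rfl | hp
    · refine ⟨y, hy, ?_⟩
      ext q
      have := Finsupp.mem_support_iff.1 hx
      simp only [Finsupp.add_apply, Finsupp.tsub_apply]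
      by_cases hq : q = p
      · subst hq
        simp only [Finsupp.single_eq_same, Finsupp.single_eq_of_ne hxy]
        omega
      · simp [Finsupp.single_eq_of_ne hq]
    · rw [Finset.mem_singleton] at hp
      subst hp
      exact ⟨x, hx, hcy⟩
  · intro f B
    have hsplit : varForm K a.support = varForm K {x} + varForm K (a.support.erase x) := by
      rw [← varForm_union (by simp), ← Finset.insert_eq, Finset.insert_erase hx]
    rw [contractions_cons, contractions_cons]
    change contraction _ (contraction _ f) B ∈ _
    -- The x-part of the full form dies against the inner contraction, so no x² arises; in the case
    -- i = x, x² would not be enough.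
    rw [hsplit, contraction_add, contraction_contraction_self, zero_add]
    refine contraction_mem _ (fun B q _ => ?_) B
    have hmem : contraction (varForm K {x}) f (insert q B) ∈
        Ideal.span {(X x : MvPolynomial (Fin n) K)} := by
      refine contraction_mem _ (fun B p _ => Ideal.mul_mem_right _ _ ?_) _
      rw [varForm]
      split_ifs with hp
      · rw [Finset.mem_singleton] at hp
        subst hp
        exact Ideal.mem_span_singleton_self _
      · exact zero_mem _
    obtain ⟨r, hr⟩ := Ideal.mem_span_singleton'.1 hmem
    rw [← hr, varForm]
    split_ifs with hq
    · rw [Finset.mem_erase] at hq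
      rw [mul_left_comm]
      refine Ideal.mul_mem_left _ _ (Ideal.subset_span ⟨_, ⟨q, hq.2, hq.1, rfl⟩, ?_⟩)
      simp only [X, monomial_mul, one_mul, add_comm]
    · rw [zero_mul]
      exact zero_mem _
  · intro f hf m hm i hi
    obtain ⟨_, ⟨q, hq, hqx, rfl⟩, hqm⟩ := mem_ideal_span_monomial_image.1 hf m hm
    rw [htot]
    have hmx := hqm x
    have hmq := hqm q
    simp only [Finsupp.add_apply, Finsupp.single_eq_same, Finsupp.single_eq_of_ne hqx,
      Finsupp.single_eq_of_ne hqx.symm] at hmx hmq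
    by_cases hix : i = x
    · subst hix
      refine ⟨q, hq, ?_⟩
      simp only [Finsupp.add_apply, Finsupp.tsub_apply, Finsupp.single_eq_of_ne hqx]
      omega
    · refine ⟨x, hx, ?_⟩
      simp only [Finsupp.add_apply, Finsupp.tsub_apply, Finsupp.single_eq_of_ne (Ne.symm hix)]
      omega
  · intro B hB r
    have hxB : x ∉ B := Finset.disjoint_right.1 hB hx
    have hyB : y ∉ B := Finset.disjoint_right.1 hB hy
    have hU : B ∪ {x, y} = insert x (insert y B) := by
      ext q
      simp only [Finset.mem_union, Finset.mem_insert, Finset.mem_singleton]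
      tauto
    refine ⟨((B.filter (· < y)).card + ((insert y B).filter (· < x)).card), ?_⟩
    rw [contractions_cons, contractions_cons]
    change contraction _ (contraction _ (Pi.single (B ∪ {x, y}) r)) = _
    rw [hU, contraction_single (by simp [hxB, hxy]), contraction_single hyB]
    · simp only [varForm, if_pos hy, Finset.mem_singleton, if_true]
      have : monomial (indExp {x, y}) (1 : K) = X x * X y := by
        rw [hind]
        simp only [X, monomial_mul, one_mul]
      rw [this, pow_add]
      congr 1
      ring
    · intro q hq
      rw [varForm, if_neg (Finset.disjoint_left.1 hB hq)]
    · intro q hq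
      rw [varForm, if_neg]
      rw [Finset.mem_singleton]
      rintro rfl
      simp [hxB, hxy] at hq

theorem exists_detects {a : Fin n →₀ ℕ} (h2 : 2 ≤ a.degree) : ∃ A c L Q, Detects K a A c L Q := by
  have hne : a.support.Nonempty := by
    rw [Finsupp.support_nonempty_iff]
    rintro rfl
    simp at h2
  by_cases h : 1 < a.support.card
  · obtain ⟨x, hx, y, hy, hxy⟩ := Finset.one_lt_card.1 h
    exact ⟨_, _, _, _, detects_of_ne hx hy hxy⟩
  · obtain ⟨x, hx⟩ := Finset.card_eq_one.1 (le_antisymm (not_lt.1 h) hne.card_pos)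
    exact ⟨_, _, _, _, detects_of_support_eq_singleton h2 hx⟩

section Families

variable {A : (Fin n →₀ ℕ) → Finset (Fin n)} {c : (Fin n →₀ ℕ) → Fin n →₀ ℕ}
  {L : (Fin n →₀ ℕ) → List (Fin n → MvPolynomial (Fin n) K)}
  {Q : (Fin n →₀ ℕ) → Ideal (MvPolynomial (Fin n) K)}

theorem contractions_flatMap_mem {l : List (Fin n →₀ ℕ)}
    (hD : ∀ a ∈ l, Detects K a (A a) (c a) (L a) (Q a)) {a : Fin n →₀ ℕ} (ha : a ∈ l)
    (f : Finset (Fin n) → MvPolynomial (Fin n) K) (B : Finset (Fin n)) :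
    contractions (l.flatMap L) f B ∈ Q a := by
  induction l generalizing B with
  | nil => simp at ha
  | cons b l ih =>
    rw [List.flatMap_cons, contractions_append]
    rcases List.mem_cons.1 ha with rfl | ha
    · exact (hD a List.mem_cons_self).mem_ideal _ _
    · exact contractions_mem _ _ (ih (fun a ha => hD a (List.mem_cons_of_mem _ ha)) ha) B

theorem contractions_flatMap_single {l : List (Fin n →₀ ℕ)}
    (hD : ∀ a ∈ l, Detects K a (A a) (c a) (L a) (Q a))
    (hl : l.Pairwise fun a b => Disjoint a.support b.support) {B : Finset (Fin n)}
    (hB : ∀ a ∈ l, Disjoint B a.support) (r : MvPolynomial (Fin n) K) :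
    ∃ k : ℕ, contractions (l.flatMap L) (Pi.single (B ∪ l.toFinset.biUnion A) r) =
      Pi.single B ((-1) ^ k * (monomial (l.map fun a => indExp (A a)).sum 1 * r)) := by
  induction l generalizing B with
  | nil => exact ⟨0, by simp [contractions]⟩
  | cons a l ih =>
    rw [List.pairwise_cons] at hl
    have ha := hD a List.mem_cons_self
    have hU : B ∪ (a :: l).toFinset.biUnion A = (B ∪ A a) ∪ l.toFinset.biUnion A := by
      rw [List.toFinset_cons, Finset.biUnion_insert, Finset.union_assoc]
    obtain ⟨k, hk⟩ := ih (fun b hb => hD b (List.mem_cons_of_mem _ hb)) hl.2 (B := B ∪ A a)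
      fun b hb => Finset.disjoint_union_left.2 ⟨hB b (List.mem_cons_of_mem _ hb),
        Finset.disjoint_of_subset_left ha.subset (hl.1 b hb)⟩
    obtain ⟨k', hk'⟩ := ha.apply_single B (hB a List.mem_cons_self)
      ((-1) ^ k * (monomial (l.map fun a => indExp (A a)).sum 1 * r))
    refine ⟨k' + k, ?_⟩
    rw [List.flatMap_cons, contractions_append, hU, hk, hk']
    congr 1
    have : monomial (((a :: l).map fun a => indExp (A a)).sum) (1 : K) =
        monomial (indExp (A a)) 1 * monomial (l.map fun a => indExp (A a)).sum 1 := by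
      rw [monomial_mul, one_mul, List.map_cons, List.sum_cons]
    rw [this, pow_add]
    ring

end Families

end LowerBound

/-! ### A class attaining the bound for disjoint supports -/

section TopClass

variable {K : Type*} [Field K] {n : ℕ} {I : Ideal (MvPolynomial (Fin n) K)}
  {A : (Fin n →₀ ℕ) → Finset (Fin n)} {c : (Fin n →₀ ℕ) → Fin n →₀ ℕ}
  {L : (Fin n →₀ ℕ) → List (Fin n → MvPolynomial (Fin n) K)}
  {Q : (Fin n →₀ ℕ) → Ideal (MvPolynomial (Fin n) K)} {G : Finset (Fin n →₀ ℕ)}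

theorem sum_apply_of_disjoint_support (hD : ∀ a ∈ G, Detects K a (A a) (c a) (L a) (Q a))
    (hG : (G : Set (Fin n →₀ ℕ)).Pairwise fun a b => Disjoint a.support b.support)
    {a : Fin n →₀ ℕ} (ha : a ∈ G) {p : Fin n} (hp : p ∈ a.support) :
    (∑ b ∈ G, (c b + indExp (A b))) p = (c a + indExp (A a)) p := by
  rw [Finsupp.finsetSum_apply]
  refine Finset.sum_eq_single a (fun b hb hba => ?_) fun h => absurd ha h
  have h1 : (c b + indExp (A b)) p ≤ b p := (hD b hb).le p
  have h2 : b p = 0 := Finsupp.notMem_support_iff.1 fun h =>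
    Finset.disjoint_left.1 (hG hb ha hba) h hp
  omega

theorem coeff_contractions_eq_zero_of_mem
    (hD : ∀ a ∈ minGens I, Detects K a (A a) (c a) (L a) (Q a))
    (hG : (minGens I : Set (Fin n →₀ ℕ)).Pairwise fun a b => Disjoint a.support b.support)
    {w : Finset (Fin n) → MvPolynomial (Fin n) K} (hw : ∀ B, w B ∈ starGradientIdeal I)
    (B : Finset (Fin n)) :
    coeff (∑ a ∈ minGens I, (c a + indExp (A a)))
      (contractions ((minGens I).toList.flatMap L) w B) = 0 := by
  have hsum : w = ∑ C : Finset (Fin n), w C • Pi.single C (1 : MvPolynomial (Fin n) K) := by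
    funext C
    rw [Finset.sum_apply, Finset.sum_eq_single C]
    · simp
    · intro C' _ hne
      simp [hne.symm]
    · simp
  -- Linearity factors each term as an element of the gradient ideal times a coefficient lying in
  -- every `Q a`. A monomial of the first factor selects one generator `a`, and the product
  -- overshoots inside its support.
  rw [hsum, map_sum, Finset.sum_apply, coeff_sum]
  refine Finset.sum_eq_zero fun C _ => ?_
  rw [map_smul, Pi.smul_apply, smul_eq_mul]
  set q := contractions ((minGens I).toList.flatMap L) (Pi.single C 1) B with hq
  by_contra h0
  obtain ⟨m₁, hm₁, m₂, hm₂, hm⟩ := Finset.mem_add.1 (support_mul _ _ (mem_support_iff.2 h0))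
  have hwC := hw C
  rw [starGradientIdeal_eq_expIdeal] at hwC
  obtain ⟨⟨a, i⟩, hai, hle⟩ := mem_expIdeal.1 hwC m₁ hm₁
  simp only [gradientIndex, Finset.mem_sigma] at hai
  have hqQ : q ∈ Q a := contractions_flatMap_mem (fun b hb => hD b (by simpa using hb))
    (by simpa using hai.1) _ _
  obtain ⟨p, hp, hlt⟩ := (hD a hai.1).exists_lt q hqQ m₂ hm₂ i hai.2
  rw [← sum_apply_of_disjoint_support hD hG hai.1 hp, ← hm, Finsupp.add_apply,
    Finsupp.add_apply] at hlt
  have h1 : (a - Finsupp.single i 1 : Fin n →₀ ℕ) p ≤ m₁ p := hle p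
  omega

theorem coeff_contractions_koszulD
    (hD : ∀ a ∈ G, Detects K a (A a) (c a) (L a) (Q a))
    (hG : (G : Set (Fin n →₀ ℕ)).Pairwise fun a b => Disjoint a.support b.support)
    (y : Finset (Fin n) → MvPolynomial (Fin n) K) (B : Finset (Fin n)) :
    coeff (∑ a ∈ G, (c a + indExp (A a)))
      (contractions (G.toList.flatMap L) (koszulD K n y) B) = 0 := by
  set s : Finset (Fin n) := G.biUnion fun a => a.support with hs
  -- The Koszul form splits along the supports. Each part belonging to a generator occurs in the
  -- list and is killed; the rest produces only variables absent from the detecting monomial.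
  have hX : (X : Fin n → MvPolynomial (Fin n) K) = ∑ a ∈ G, varForm K a.support + varForm K sᶜ := by
    funext p
    rw [Pi.add_apply, Finset.sum_apply]
    by_cases hp : p ∈ s
    · obtain ⟨a, ha, hpa⟩ := Finset.mem_biUnion.1 hp
      rw [Finset.sum_eq_single a]
      · simp [varForm, Finsupp.mem_support_iff.1 hpa, hp]
      · intro b hb hba
        rw [varForm, if_neg (Finset.disjoint_right.1 (hG hb ha hba) hpa)]
      · exact fun h => absurd ha h
    · rw [Finset.sum_eq_zero]
      · simp [varForm, hp]
      · intro a ha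
        rw [varForm, if_neg fun h => hp (Finset.mem_biUnion.2 ⟨a, ha, h⟩)]
  have hzero : contractions (G.toList.flatMap L) (∑ a ∈ G, contraction (varForm K a.support) y) = 0 := by
    rw [map_sum]
    refine Finset.sum_eq_zero fun a ha => contractions_contraction_of_mem ?_ y
    exact List.mem_flatMap.2 ⟨a, by simpa using ha, (hD a ha).mem_list⟩
  rw [koszulD_eq_contraction, hX, contraction_add, contraction_sum, map_add, hzero, zero_add]
  by_contra h0
  have hmem : contractions (G.toList.flatMap L) (contraction (varForm K sᶜ) y) B ∈
      Ideal.span (X '' ((sᶜ : Finset (Fin n)) : Set (Fin n))) := by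
    refine contractions_mem _ _ (contraction_mem _ fun B p _ => Ideal.mul_mem_right _ _ ?_) B
    rw [varForm]
    split_ifs with hp
    · exact Ideal.subset_span ⟨p, hp, rfl⟩
    · exact zero_mem _
  obtain ⟨p, hp, hne⟩ := mem_ideal_span_X_image.1 hmem _ (mem_support_iff.2 h0)
  rw [Finset.mem_coe, Finset.mem_compl] at hp
  apply hne
  rw [Finsupp.finsetSum_apply]
  refine Finset.sum_eq_zero fun a ha => ?_
  have h1 : (c a + indExp (A a)) p ≤ a p := (hD a ha).le p
  have h2 : a p = 0 := Finsupp.notMem_support_iff.1 fun h => hp (Finset.mem_biUnion.2 ⟨a, ha, h⟩)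
  omega

theorem mem_regSet_starGradientIdeal_of_disjoint (hne : (minGens I).Nonempty)
    (h2 : ∀ a ∈ minGens I, 2 ≤ a.degree)
    (hG : (minGens I : Set (Fin n →₀ ℕ)).Pairwise fun a b => Disjoint a.support b.support) :
    (∑ a ∈ minGens I, (a.degree : ℤ)) - 2 * ((minGens I).card : ℤ) + 1 ∈
      regSet (starGradientIdeal I) := by
  -- Junk data in degrees below 2 let the choice functions be defined on all exponents.
  have hex : ∀ a : Fin n →₀ ℕ, ∃ A c L Q, 2 ≤ a.degree → Detects K a A c L Q := fun a => by
    by_cases h : 2 ≤ a.degree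
    · obtain ⟨A, c, L, Q, h'⟩ := exists_detects (K := K) h
      exact ⟨A, c, L, Q, fun _ => h'⟩
    · exact ⟨∅, 0, [], ⊥, fun h' => absurd h' h⟩
  choose A c L Q hD' using hex
  have hD := fun a ha => hD' a (h2 a ha)
  set U := (minGens I).biUnion A with hU
  set C := ∑ a ∈ minGens I, c a with hC
  have hCdeg : C.degree + (minGens I).card * 2 = ∑ a ∈ minGens I, a.degree := by
    rw [← Finset.sum_congr rfl fun a ha => (hD a ha).degree_add, Finset.sum_add_distrib,
      Finset.sum_const, smul_eq_mul, hC, map_sum]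
  obtain ⟨N, hN⟩ : ∃ N, U.card = N + 1 := by
    refine Nat.exists_eq_succ_of_ne_zero (Finset.card_pos.2 ?_).ne'
    obtain ⟨a, ha⟩ := hne
    obtain ⟨p, hp⟩ := (hD a ha).nonempty
    exact ⟨p, Finset.mem_biUnion.2 ⟨a, ha, hp⟩⟩
  set z : Finset (Fin n) → MvPolynomial (Fin n) K := Pi.single U (monomial C 1) with hz
  have hzc : z ∈ koszulChains ⊤ (N + 1) (C.degree + (N + 1)) := by
    intro B
    refine ⟨trivial, fun m hm => ?_⟩
    by_cases hB : B = U
    · subst hB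
      rw [hz, Pi.single_eq_same] at hm
      have hm' := Finset.mem_singleton.1 (support_monomial_subset hm)
      subst hm'
      exact ⟨hN, by rw [hN]⟩
    · simp [hz, hB] at hm
  have hdz : koszulD K n z ∈ koszulCycles (starGradientIdeal I) N (C.degree + (N + 1)) := by
    refine ⟨fun B => ⟨contraction_mem _ (fun B p hp => ?_) B,
      (koszulD_mem_koszulChains hzc B).2⟩, koszulD_koszulD z⟩
    by_cases hB : insert p B = U
    · have hpU : p ∈ U := hB ▸ Finset.mem_insert_self p B
      obtain ⟨a, ha, hpa⟩ := Finset.mem_biUnion.1 hpU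
      obtain ⟨i, hi, hai⟩ := (hD a ha).exists_eq p hpa
      have heq : X p * z (insert p B) = monomial (Finsupp.single p 1 + C) (1 : K) := by
        rw [hB, hz, Pi.single_eq_same, X, monomial_mul, one_mul]
      rw [heq, starGradientIdeal_eq_expIdeal, mem_expIdeal]
      intro m hm
      have hm' := Finset.mem_singleton.1 (support_monomial_subset hm)
      refine ⟨⟨a, i⟩, Finset.mem_sigma.2 ⟨ha, hi⟩, ?_⟩
      rw [gradientExp, hm', ← hai, add_comm, hC, ← Finset.add_sum_erase _ _ ha]
      exact add_le_add_right le_self_add _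
    · simp [hz, hB]
  refine ⟨N, C.degree + (N + 1), ?_, ?_⟩
  · rw [gradedBetti_ne_zero_iff]
    intro hle
    obtain ⟨w, hw, hdw⟩ := hle hdz
    -- z - w is a cycle over S in positive homological degree N + 1, hence a boundary.
    obtain ⟨y, -, hdy⟩ := koszulCycles_top_le (by omega)
      ⟨sub_mem hzc (koszulChains_mono le_top _ _ hw),
        show koszulD K n (z - w) = 0 by rw [map_sub, hdw, sub_self]⟩
    have hzw : z = w + koszulD K n y := by rw [hdy]; abel
    have hcoeff : coeff (∑ a ∈ minGens I, (c a + indExp (A a)))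
        (contractions ((minGens I).toList.flatMap L) z ∅) = 0 := by
      rw [hzw, map_add, Pi.add_apply, coeff_add,
        coeff_contractions_eq_zero_of_mem hD hG (fun B => (hw B).1),
        coeff_contractions_koszulD hD hG, add_zero]
    have hpair : (minGens I).toList.Pairwise fun a b => Disjoint a.support b.support := by
      refine (Finset.nodup_toList _).imp_of_mem ?_
      intro a b ha hb hab
      exact hG (by simpa using ha) (by simpa using hb) hab
    obtain ⟨k, hk⟩ := contractions_flatMap_single (fun a ha => hD a (by simpa using ha)) hpair
      (B := ∅) (fun _ _ => Finset.disjoint_empty_left _) (monomial C 1)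
    rw [Finset.toList_toFinset, Finset.empty_union, ← hU, ← hz] at hk
    rw [hk, Pi.single_eq_same, Finset.sum_map_toList, monomial_mul, one_mul,
      Finset.sum_add_distrib, add_comm] at hcoeff
    rcases neg_one_pow_eq_or (MvPolynomial (Fin n) K) k with h | h <;>
      simp [h, hC] at hcoeff
  · rw [← Nat.cast_sum, ← hCdeg]
    push_cast
    ring

end TopClass

/-! ### Monomial complete intersections -/

section CompleteIntersection

/-- The relations of a regular sequence have their coefficients in the ideal it generates. -/
theorem mem_of_sum_mul_eq_zero {R : Type*} [CommRing R] (r : ℕ → R) (N : ℕ)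
    (hr : ∀ i < N, ∀ x, r i * x ∈ Ideal.span (r '' (Finset.range i : Set ℕ)) →
      x ∈ Ideal.span (r '' (Finset.range i : Set ℕ)))
    (f : ℕ → R) (hf : ∑ i ∈ Finset.range N, f i * r i = 0) :
    ∀ i < N, f i ∈ Ideal.span (r '' (Finset.range N : Set ℕ)) := by
  induction N generalizing f with
  | zero => simp
  | succ N ih =>
    have hle : Ideal.span (r '' (Finset.range N : Set ℕ)) ≤
        Ideal.span (r '' (Finset.range (N + 1) : Set ℕ)) :=
      Ideal.span_mono (Set.image_mono (by simp))
    rw [Finset.sum_range_succ] at hf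
    have hN : f N ∈ Ideal.span (r '' (Finset.range N : Set ℕ)) := by
      refine hr N (Nat.lt_succ_self N) _ ?_
      rw [mul_comm, eq_neg_of_add_eq_zero_right hf]
      refine neg_mem (Ideal.sum_mem _ fun i hi => Ideal.mul_mem_left _ _ (Ideal.subset_span ?_))
      exact ⟨i, hi, rfl⟩
    obtain ⟨h, hh⟩ : ∃ h : ℕ → R, ∑ i ∈ Finset.range N, h i * r i = f N := by
      obtain ⟨h, hh⟩ := (Submodule.mem_span_image_finset_iff_exists_fun R).1 hN
      refine ⟨fun i => if hi : i ∈ Finset.range N then h ⟨i, hi⟩ else 0, ?_⟩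
      rw [← hh, ← Finset.sum_coe_sort]
      refine Finset.sum_congr rfl fun i _ => ?_
      simp only [dif_pos i.2, smul_eq_mul]
    -- Writing f N = ∑ h i * r i absorbs the last term into a shorter relation; the corrections h i
    -- * r N already lie in the larger ideal.
    have hrel : ∑ i ∈ Finset.range N, (f i + h i * r N) * r i = 0 := by
      rw [← hf, ← hh, Finset.sum_mul, ← Finset.sum_add_distrib]
      exact Finset.sum_congr rfl fun i _ => by ring
    intro i hi
    rcases Nat.lt_succ_iff_lt_or_eq.1 hi with hi | rfl
    · have := hle (ih (fun i hi => hr i (by omega)) _ hrel i hi)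
      refine (Ideal.add_mem_iff_left _ (Ideal.mul_mem_left _ _ (Ideal.subset_span ?_))).1 this
      exact ⟨N, by simp, rfl⟩
    · exact hle hN

theorem mem_ofList_of_sum_mul_eq_zero {R : Type*} [CommRing R] {rs : List R}
    (hrs : RingTheory.Sequence.IsWeaklyRegular R rs) (f : Fin rs.length → R)
    (hf : ∑ i, f i * rs[i] = 0) (i : Fin rs.length) : f i ∈ Ideal.ofList rs := by
  set r : ℕ → R := fun i => rs.getD i 0 with hr
  have htake : ∀ k ≤ rs.length,
      Ideal.ofList (rs.take k) = Ideal.span (r '' (Finset.range k : Set ℕ)) := by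
    intro k hk
    rw [Ideal.ofList]
    congr 1
    ext x
    simp only [Set.mem_ofPred_eq, List.mem_take_iff_getElem, Set.mem_image, Finset.mem_coe,
      Finset.mem_range, hr]
    constructor
    · rintro ⟨i, hi, rfl⟩
      exact ⟨i, by omega, List.getD_eq_getElem _ _ (by omega)⟩
    · rintro ⟨i, hi, rfl⟩
      exact ⟨i, by omega, (List.getD_eq_getElem _ _ (by omega)).symm⟩
  have key := mem_of_sum_mul_eq_zero r rs.length ?_
    (fun k => if h : k < rs.length then f ⟨k, h⟩ else 0) ?_ i i.2
  · rw [← htake _ le_rfl, List.take_length] at key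
    simpa using key
  · intro k hk x hx
    rw [← htake k hk.le] at hx ⊢
    have := hrs.regular_mod_prev k hk
    rw [smul_eq_mul, Ideal.mul_top, isSMulRegular_quotient_iff_mem_of_smul_mem] at this
    refine this x ?_
    rw [hr] at hx
    simp only [List.getD_eq_getElem _ _ hk] at hx
    exact hx
  · rw [Finset.sum_range]
    rw [← hf]
    refine Finset.sum_congr rfl fun k _ => ?_
    simp [hr]

theorem map_mk_eq_one_of_sub_one_mem {R : Type*} [CommRing R] {ι : Type*} [DecidableEq ι]
    {J : Ideal R} {E : Matrix ι ι R} (hE : ∀ k l, (E - 1) k l ∈ J) :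
    E.map (Ideal.Quotient.mk J) = 1 := by
  have h1 : (E - 1).map (Ideal.Quotient.mk J) = 0 := by
    ext k l
    exact Ideal.Quotient.eq_zero_iff_mem.2 (hE k l)
  rw [Matrix.map_sub _ (map_sub _), Matrix.map_one _ (map_zero _) (map_one _), sub_eq_zero] at h1
  exact h1

/-- If the ideal generated by `u` is generated by a family `r` whose relations have coefficients in
that ideal, and `u` is a minimal system of generators, then the same holds for the relations
of `u`. -/
theorem mem_of_dotProduct_eq_zero {R : Type*} [CommRing R] {ι κ : Type*} [Fintype ι] [Fintype κ]
    {I M : Ideal R} (hM : M ≠ ⊤) (hIM : I ≤ M) {u : ι → R} {r : κ → R}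
    (hu : I = Ideal.span (Set.range u)) (hr : I = Ideal.span (Set.range r))
    (hrel : ∀ f : κ → R, f ⬝ᵥ r = 0 → ∀ k, f k ∈ I)
    (hmin : ∀ f : ι → R, f ⬝ᵥ u = 0 → ∀ k, f k ∈ M)
    (f : ι → R) (hf : f ⬝ᵥ u = 0) (k : ι) : f k ∈ I := by
  classical
  have hur : ∀ k, ∃ c : κ → R, c ⬝ᵥ r = u k := fun k => by
    have : u k ∈ Ideal.span (Set.range r) := hr ▸ hu ▸ Ideal.subset_span ⟨k, rfl⟩
    exact (Submodule.mem_span_range_iff_exists_fun R).1 this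
  have hru : ∀ k, ∃ c : ι → R, c ⬝ᵥ u = r k := fun k => by
    have : r k ∈ Ideal.span (Set.range u) := hu ▸ hr ▸ Ideal.subset_span ⟨k, rfl⟩
    exact (Submodule.mem_span_range_iff_exists_fun R).1 this
  choose P hP using hur
  choose N hN using hru
  let P' : Matrix ι κ R := Matrix.of P
  let N' : Matrix κ ι R := Matrix.of N
  have hPr : P'.mulVec r = u := funext hP
  have hNu : N'.mulVec u = r := funext hN
  have hNP : ∀ k l, (N' * P' - 1 : Matrix κ κ R) k l ∈ I := fun k l => by
    refine hrel ((N' * P' - 1 : Matrix κ κ R) k) ?_ l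
    have : (N' * P' - 1).mulVec r = 0 := by
      rw [Matrix.sub_mulVec, ← Matrix.mulVec_mulVec, hPr, hNu, Matrix.one_mulVec, sub_self]
    exact congrFun this k
  have hPN : ∀ k l, (P' * N' - 1 : Matrix ι ι R) k l ∈ M := fun k l => by
    refine hmin ((P' * N' - 1 : Matrix ι ι R) k) ?_ l
    have : (P' * N' - 1).mulVec u = 0 := by
      rw [Matrix.sub_mulVec, ← Matrix.mulVec_mulVec, hNu, hPr, Matrix.one_mulVec, sub_self]
    exact congrFun this k
  -- Modulo M the transition matrices are inverse to each other, so both families have equally many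
  -- members. Over R/I the one-sided inverse N'P' = 1 then gives P'N' = 1 as well.
  have hcard : Fintype.card κ = Fintype.card ι := by
    have : Nontrivial (R ⧸ M) := Ideal.Quotient.nontrivial_iff.2 hM
    have e1 := map_mk_eq_one_of_sub_one_mem hPN
    have e2 := map_mk_eq_one_of_sub_one_mem fun k l => hIM (hNP k l)
    rw [Matrix.map_mul] at e1 e2
    exact (card_eq_of_linearEquiv (R ⧸ M) (Matrix.toLin'OfInv e1 e2)).symm
  have e3 := map_mk_eq_one_of_sub_one_mem hNP
  rw [Matrix.map_mul, Matrix.mul_eq_one_comm_of_card_eq _ _ _ hcard] at e3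
  have hfP : ∀ l, Matrix.vecMul f P' l ∈ I := hrel _ (by
    rw [← Matrix.dotProduct_mulVec, hPr, hf])
  have hfP' : Matrix.vecMul (Ideal.Quotient.mk I ∘ f) (P'.map (Ideal.Quotient.mk I)) = 0 := by
    funext l
    rw [← RingHom.map_vecMul]
    exact Ideal.Quotient.eq_zero_iff_mem.2 (hfP l)
  have hf0 : Ideal.Quotient.mk I ∘ f = 0 := by
    rw [← Matrix.vecMul_one (Ideal.Quotient.mk I ∘ f), ← e3, ← Matrix.vecMul_vecMul, hfP',
      Matrix.zero_vecMul]
  exact Ideal.Quotient.eq_zero_iff_mem.1 (congrFun hf0 k)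

variable {K : Type*} [Field K] {n : ℕ} {I : Ideal (MvPolynomial (Fin n) K)}

/-- Compare coefficients at x^a: no other minimal generator divides x^a. -/
theorem constantCoeff_eq_zero_of_dotProduct_eq_zero
    (f : minGens I → MvPolynomial (Fin n) K)
    (hf : f ⬝ᵥ (fun a => monomial a.1 (1 : K)) = 0) (a : minGens I) : constantCoeff (f a) = 0 := by
  have h := congrArg (coeff a.1) hf
  rw [dotProduct, coeff_sum, coeff_zero, Finset.sum_eq_single a] at h
  · have h' := coeff_mul_monomial 0 a.1 (1 : K) (f a)
    rw [zero_add, mul_one] at h'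
    rw [constantCoeff_eq, ← h', h]
  · intro b _ hba
    rw [coeff_mul_monomial', if_neg]
    intro hle
    apply hba
    refine Subtype.ext (hle.antisymm ?_)
    exact (mem_minGens.1 a.2).2 (mem_minGens.1 b.2).1 hle
  · simp

/-- The minimal generators of a monomial complete intersection have disjoint supports. -/
theorem IsCompleteIntersection.pairwise_disjoint_support (hI : IsMonomialIdeal I) (htop : I ≠ ⊤)
    (hci : IsCompleteIntersection I) :
    (minGens I : Set (Fin n →₀ ℕ)).Pairwise fun a b => Disjoint a.support b.support := by
  obtain ⟨rs, hrs, hIrs⟩ := hci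
  have hspan : I = Ideal.span (Set.range fun a : minGens I => monomial a.1 (1 : K)) := by
    conv_lhs => rw [hI.eq_expIdeal, expIdeal]
    congr 1
    ext f
    simp
  have hr : I = Ideal.span (Set.range fun i : Fin rs.length => rs[i]) := by
    rw [hIrs, Ideal.ofList]
    congr 1
    ext x
    simp only [Set.mem_ofPred_eq, Set.mem_range, List.mem_iff_get]
    rfl
  have hIM : I ≤ RingHom.ker (constantCoeff : MvPolynomial (Fin n) K →+* K) := by
    rw [hspan, Ideal.span_le]
    rintro _ ⟨a, rfl⟩
    have : a.1 ≠ 0 := fun h => degree_ne_zero_of_mem_minGens htop a.2 (by rw [h, map_zero])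
    simp [constantCoeff_monomial, this]
  have hrel := mem_of_dotProduct_eq_zero (RingHom.ker_ne_top _) hIM hspan hr
    (fun f hf k => hIrs ▸ mem_ofList_of_sum_mul_eq_zero hrs.toIsWeaklyRegular f hf k)
    constantCoeff_eq_zero_of_dotProduct_eq_zero
  intro a ha b hb hab
  rw [Finset.disjoint_left]
  intro p hpa hpb
  have hpa := Finsupp.mem_support_iff.1 hpa
  have hpb := Finsupp.mem_support_iff.1 hpb
  classical
  have hab' : (⟨a, ha⟩ : minGens I) ≠ ⟨b, hb⟩ := fun h => hab (congrArg Subtype.val h)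
  let e : (x : minGens I) → (Fin n →₀ ℕ) → minGens I → MvPolynomial (Fin n) K :=
    fun x m => Pi.single x (monomial m 1)
  -- The syzygy (b/gcd)·a = (a/gcd)·b puts b/gcd into I. Minimality of b then forces the gcd to be
  -- 1.
  have hmem := hrel (e ⟨a, ha⟩ (b - a ⊓ b) - e ⟨b, hb⟩ (a - a ⊓ b)) (by
      rw [sub_dotProduct, single_dotProduct, single_dotProduct, monomial_mul, monomial_mul,
        sub_eq_zero]
      congr 2
      ext q
      simp only [Finsupp.add_apply, Finsupp.tsub_apply, Finsupp.inf_apply]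
      omega) ⟨a, ha⟩
  simp only [e] at hmem
  rw [Pi.sub_apply, Pi.single_eq_same, Pi.single_eq_of_ne hab', sub_zero] at hmem
  have hle := (mem_minGens.1 hb).2 hmem tsub_le_self p
  simp only [Finsupp.tsub_apply, Finsupp.inf_apply] at hle
  omega

end CompleteIntersection

end MonomialGradient

end

/-! ### The three assertions -/

open MonomialGradient in
theorem proposition2p1 {K : Type*} [Field K] (n : ℕ) (I : Ideal (MvPolynomial (Fin n) K))
    (hmon : IsMonomialIdeal I) (hbot : I ≠ ⊥) (htop : I ≠ ⊤)
    (hgrad : gradientIdeal I = starGradientIdeal I) :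
    IsGreatest (regSet (gradientIdeal I)) (regularity (gradientIdeal I)) ∧
    (initialDegree I : ℤ) - 1 ≤ regularity (gradientIdeal I) ∧
    ((∀ i j : Fin n, X i ∈ I → X j ∈ I → i = j) →
      regularity (gradientIdeal I) ≤
        (∑ a ∈ minGens I, (a.degree : ℤ)) - 2 * ((minGens I).card : ℤ) + 1) ∧
    (IsCompleteIntersection I →
      ((∀ i : Fin n, X i ∉ I) ∨ ∃ i : Fin n, I = Ideal.span {X i}) →
      regularity (gradientIdeal I) =
        (∑ a ∈ minGens I, (a.degree : ℤ)) - 2 * ((minGens I).card : ℤ) + 1) := by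
  rw [hgrad]
  obtain ⟨a, ha, hmin⟩ := exists_minGens_degree_le hmon hbot
  have hmem := degree_sub_one_mem_regSet htop ha hmin
  have hbdd : BddAbove (regSet (starGradientIdeal I)) := by
    rw [starGradientIdeal_eq_expIdeal]
    exact bddAbove_regSet_expIdeal _ _
  -- `sSup` on ℤ is a genuine maximum only for nonempty sets bounded above; both conditions are now
  -- available.
  have hgreat : IsGreatest (regSet (starGradientIdeal I)) (regularity (starGradientIdeal I)) :=
    ⟨Int.csSup_mem ⟨_, hmem⟩ hbdd, fun _ hr => le_csSup hbdd hr⟩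
  have htwo : (∀ i : Fin n, X i ∉ I) → ∀ b ∈ minGens I, 2 ≤ b.degree := fun hX b hb => by
    have h0 := degree_ne_zero_of_mem_minGens htop hb
    by_contra h
    obtain ⟨i, -, hi⟩ := exists_X_mem_of_degree_eq_one hb (by omega)
    exact hX i hi
  refine ⟨hgreat, ?_, fun huniq => ?_, fun hci hvar => ?_⟩
  · refine le_trans ?_ (hgreat.2 hmem)
    have := initialDegree_le hmon ha
    omega
  · by_cases hX : ∀ i : Fin n, X i ∉ I
    · exact le_of_mem_regSet_starGradientIdeal (htwo hX) hgreat.1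
    · have hone : ∀ b ∈ minGens I, b.degree = 1 → ∀ b' ∈ minGens I, b'.degree = 1 → b' = b := by
        intro b hb h1 b' hb' h1'
        obtain ⟨i, rfl, hi⟩ := exists_X_mem_of_degree_eq_one hb h1
        obtain ⟨j, rfl, hj⟩ := exists_X_mem_of_degree_eq_one hb' h1'
        rw [huniq i j hi hj]
      obtain ⟨i, hi⟩ := not_forall_not.1 hX
      obtain ⟨b, hb, hbi⟩ : ∃ b ∈ minGens I, b ≤ Finsupp.single i 1 := by
        rw [hmon.eq_expIdeal] at hi
        exact mem_expIdeal.1 hi _ (by simp [X])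
      have hdeg : b.degree = 1 := by
        have h1 := Finsupp.degree_mono hbi
        rw [Finsupp.degree_single] at h1
        have h2 := degree_ne_zero_of_mem_minGens htop hb
        omega
      obtain ⟨j, hj, -⟩ := exists_X_mem_of_degree_eq_one hb hdeg
      have hreg : regularity (starGradientIdeal I) = 0 := by
        have h1 := hgreat.1
        rw [starGradientIdeal_eq_top (hj ▸ hb)] at h1 ⊢
        exact eq_zero_of_mem_regSet_top h1
      -- The variable contributes 1 - 2 = -1 to ∑ (deg u - 2), compensated by the final + 1; all
      -- other generators contribute at least 0.
      have hsum : ∑ c ∈ (minGens I).erase b, 2 ≤ ∑ c ∈ (minGens I).erase b, c.degree := by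
        refine Finset.sum_le_sum fun c hc => ?_
        obtain ⟨hcb, hc⟩ := Finset.mem_erase.1 hc
        have h0 := degree_ne_zero_of_mem_minGens htop hc
        have h1 : c.degree ≠ 1 := fun h => hcb (hone b hb hdeg c hc h)
        omega
      have h1 := Finset.add_sum_erase (minGens I) (fun c => c.degree) hb
      have h2 := Finset.card_erase_add_one hb
      rw [Finset.sum_const, smul_eq_mul] at hsum
      rw [hreg, ← Nat.cast_sum]
      omega
  · rcases hvar with hX | ⟨i, hi⟩
    · refine le_antisymm (le_of_mem_regSet_starGradientIdeal (htwo hX) hgreat.1) (hgreat.2 ?_)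
      exact mem_regSet_starGradientIdeal_of_disjoint ⟨a, ha⟩ (htwo hX)
        (hci.pairwise_disjoint_support hmon htop)
    · have hle : ∀ b ∈ minGens I, b = Finsupp.single i 1 := by
        intro b hb
        have h1 : monomial b (1 : K) ∈ Ideal.span (X '' ({i} : Set (Fin n))) := by
          rw [Set.image_singleton, ← hi]
          exact (mem_minGens.1 hb).1
        obtain ⟨j, hj, hbj⟩ := mem_ideal_span_X_image.1 h1 b (by simp)
        rw [Set.mem_singleton_iff] at hj
        subst hj
        have h2 : Finsupp.single j 1 ≤ b := single_le_of_mem_support (Finsupp.mem_support_iff.2 hbj)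
        refine le_antisymm ((mem_minGens.1 hb).2 ?_ h2) h2
        rw [hi]
        exact Ideal.mem_span_singleton_self _
      have hG : minGens I = {Finsupp.single i 1} :=
        Finset.eq_singleton_iff_nonempty_unique_mem.2 ⟨⟨a, ha⟩, hle⟩
      have h1 := hgreat.1
      have hreg : regularity (starGradientIdeal I) = 0 := by
        rw [starGradientIdeal_eq_top (i := i) (by simp [hG])] at h1 ⊢
        exact eq_zero_of_mem_regSet_top h1
      rw [hreg, hG]
      simp
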